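/- **Twisted toroidal algebras.** Let $\dot{\mathfrak g}$ be a finite-dimensional complex Lie algebra with Killing form $(\cdot,\cdot)$, and let $\Sigma=(\sigma_0,\dots,\sigma_n)$ be pairwise commuting automorphisms of $\dot{\mathfrak g}$ of finite orders $n_0,\dots,n_n$. Put $\epsilon_j=e^{2\pi i/n_j}$ and, for $\mathbf m\in\mathbb Z^{n+1}$, $\dot{\mathfrak g}_{\overline{\mathbf m}}=\{x\in\dot{\mathfrak g}\mid \sigma_j(x)=\epsilon_j^{m_j}x,\ 0\le j\le n\}$. Let $\mathcal R=\mathbb C[t_0^{\pm1},\dots,t_n^{\pm1}]$, let $\mathcal K=\Omega^1_{\mathcal R}/d\mathcal R$, which is spanned by the $t^{\mathbf m}k_i$ with $k_i=t_i^{-1}dt_i$ subject to $\sum_p m_pt^{\mathbf m}k_p=0$, and let $d_j=t_j\,\partial/\partial t_j$. Then $\dot{\mathfrak g}\otimes\mathcal R\oplus\mathcal K\oplus\bigoplus_j\mathbb Cd_j$ is a Lie algebra with $$[x\otimes f,y\otimes g]=[x,y]\otimes fg+(x,y)\,g\,df,\quad [d_j,x\otimes t^{\mathbf r}]=r_j\,x\otimes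 t^{\mathbf r},\quad [d_j,t^{\mathbf r}k_i]=r_jt^{\mathbf r}k_i,$$ $[\mathcal K,\mathcal K]=[\mathcal K,\dot{\mathfrak g}\otimes\mathcal R]=0$, $[d_i,d_j]=0$. The twisted $(n+1)$-toroidal algebra of $\Sigma$ is its subalgebra $$\mathfrak g(\Sigma)=\bigoplus_{\mathbf m}\dot{\mathfrak g}_{\overline{\mathbf m}}\otimes t^{\mathbf m}\ \oplus\ \mathcal K(\Sigma)\ \oplus\ \bigoplus_j\mathbb Cd_j,$$ where $\mathcal K(\Sigma)$ is spanned by the $t_0^{n_0m_0}\cdots t_n^{n_nm_n}k_i$. **Root systems.** Let $\dot{\mathfrak h}_0$ be a Cartan subalgebra of $\dot{\mathfrak g}_{\overline{\mathbf 0}}$ and $\mathfrak h=\dot{\mathfrak h}_0\oplus\bigoplus_j\mathbb Cd_j\oplus\bigoplus_j\mathbb Ck_j$, with the symmetric bilinear form given by the Killing form of $\dot{\mathfrak g}$ on $\dot{\mathfrak h}_0$ and by $(d_i,k_j)=\delta_{ij}$, all other products among the summands being zero. Let $\delta_j\in\mathfrak h^*$ be the form with $\delta_j(d_i)=\delta_{ij}$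 that vanishes on $\dot{\mathfrak h}_0$ and on all $k_i$; extend the elements of $\dot{\mathfrak h}_0^*$ by zero; put $V=\dot{\mathfrak h}_0^*\oplus\bigoplus_j\mathbb C\delta_j$. When the form on $\mathfrak h$ is nondegenerate, it carries over to $\mathfrak h^*$, and the root system of $\mathfrak g(\Sigma)$ is the set $R$ of all $\alpha\in V$ with $(\alpha,\alpha)\ne0$ for which some nonzero $x\in\mathfrak g(\Sigma)$ satisfies $[h,x]=\alpha(h)x$ for all $h\in\mathfrak h$. **Theorem.** Let $\ell\ge1$ and $m,n\ge0$ be integers. On the matrices of size $2\ell+2^{m+1}$ let $J_k$, $0\le k\le m$, be the diagonal matrix whose first $2\ell$ diagonal entries are $1$, and whose $(2\ell+1+j)$-th diagonal entry, $0\le j<2^{m+1}$, is $(-1)^{\lfloor j/2^k\rfloor}$. Write $\mathrm{Ad}(J_k)(X)=J_kXJ_k^{-1}$. (1) Let $m\le n$, let $\dot{\mathfrak g}$ be the Lie algebra of antisymmetric complex matrices of size $2\ell+2^{m+1}$ (type $D_{\ell+2^m}$), and let $\sigma_k=\mathrm{Ad}(J_k)$ for $0\le k\le m$ and $\sigma_k=\mathrm{id}$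 for $m<k\le n$. Then the $\sigma_k$ commute, $\sigma_k$ has order $2$ for $k\le m$ and order $1$ for $k>m$, and for every Cartan subalgebra $\dot{\mathfrak h}_0$ of $\dot{\mathfrak g}_{\overline{\mathbf 0}}$ the form on $\mathfrak h$ is nondegenerate and there is a basis $\varepsilon_1,\dots,\varepsilon_\ell$ of $\dot{\mathfrak h}_0^*$ with $(\varepsilon_i,\varepsilon_j)=c\,\delta_{ij}$ for a real $c>0$, such that the root system of $\mathfrak g(\Sigma)$ is $$R(B_\ell)^{(2,\dots,2,1,\dots,1)}=\Big\{\pm\varepsilon_i+\sum_{j=0}^nk_j\delta_j\Big\}\cup\Big\{\pm\varepsilon_i\pm\varepsilon_{i'}+\sum_{j=0}^m2k_j\delta_j+\sum_{j=m+1}^nk_j\delta_j\ \Big|\ i\ne i'\Big\},\qquad k_j\in\mathbb Z.$$ (2) Let $m<n$, let $\dot{\mathfrak g}$ be the Lie algebra of traceless complex matrices of size $2\ell+2^{m+1}$ (type $A_{2\ell+2^{m+1}-1}$), and let $\sigma_0(X)=-X^T$, $\sigma_k=\mathrm{Ad}(J_{k-1})$ for $1\le k\le m+1$ and $\sigma_k=\mathrm{id}$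 for $m+1<k\le n$. Then the $\sigma_k$ commute, $\sigma_k$ has order $2$ for $k\le m+1$ and order $1$ for $k>m+1$, and for every Cartan subalgebra $\dot{\mathfrak h}_0$ of $\dot{\mathfrak g}_{\overline{\mathbf 0}}$ the form on $\mathfrak h$ is nondegenerate and there is a basis $\varepsilon_1,\dots,\varepsilon_\ell$ of $\dot{\mathfrak h}_0^*$ with $(\varepsilon_i,\varepsilon_j)=c\,\delta_{ij}$ for a real $c>0$, such that the root system of $\mathfrak g(\Sigma)$ is $$\begin{aligned}R(BC_\ell)^{(2,\dots,2,1,\dots,1)}(2)=&\Big\{\pm\varepsilon_i+\sum_{j=0}^nk_j\delta_j\Big\}\cup\Big\{\pm\varepsilon_i\pm\varepsilon_{i'}+k_0\delta_0+\sum_{j=1}^{m+1}2k_j\delta_j+\sum_{j=m+2}^nk_j\delta_j\ \Big|\ i\ne i'\Big\}\\&\cup\Big\{\pm2\varepsilon_i+(2k_0+1)\delta_0+\sum_{j=1}^{m+1}2k_j\delta_j+\sum_{j=m+2}^nk_j\delta_j\Big\},\qquad k_j\in\mathbb Z.\end{aligned}$$ -/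

import Mathlib

noncomputable section

namespace Toroidal

variable (N : ℕ) (𝔤 : Type) [LieRing 𝔤] [LieAlgebra ℂ 𝔤]

/-- Multi-degrees `(m_0, …, m_N) ∈ ℤ^{N+1}`. -/
abbrev Deg : Type := Fin (N + 1) → ℤ

/-- The multi-loop algebra `𝔤 ⊗ ℂ[t_0^{±1}, …, t_N^{±1}]`, as the space of Laurent polynomials
with coefficients in `𝔤`. -/
abbrev Loop : Type := Deg N →₀ 𝔤

variable {N 𝔤} in
/-- The element `x ⊗ t^m`. -/
def tens (m : Deg N) : 𝔤 →ₗ[ℂ] Loop N 𝔤 := Finsupp.lsingle m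

variable {N 𝔤} in
theorem loop_induction {P : Loop N 𝔤 → Prop} (f : Loop N 𝔤) (h0 : P 0)
    (h1 : ∀ (m : Deg N) (x : 𝔤), P (tens m x))
    (hadd : ∀ f g, P f → P g → P (f + g)) : P f := by
  induction f using Finsupp.induction_linear with
  | zero => exact h0
  | add f g hf hg => exact hadd f g hf hg
  | single m x => exact h1 m x

variable {N 𝔤} in
/-- The bilinear map on the multi-loop algebra that is given by `B m r x y` on `x ⊗ t^m` and
`y ⊗ t^r`. -/
def bilinLoop {M : Type} [AddCommGroup M] [Module ℂ M] (B : Deg N → Deg N → 𝔤 →ₗ[ℂ] 𝔤 →ₗ[ℂ] M) :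
    Loop N 𝔤 →ₗ[ℂ] Loop N 𝔤 →ₗ[ℂ] M :=
  Finsupp.lsum ℂ fun m => (Finsupp.lsum ℂ fun r => (B m r).flip).flip

variable {N 𝔤} in
theorem bilinLoop_tens {M : Type} [AddCommGroup M] [Module ℂ M]
    (B : Deg N → Deg N → 𝔤 →ₗ[ℂ] 𝔤 →ₗ[ℂ] M) (m r : Deg N) (x y : 𝔤) :
    bilinLoop B (tens m x) (tens r y) = B m r x y := by
  simp [bilinLoop, tens]

/-- The bracket of the multi-loop algebra, `[x ⊗ t^m, y ⊗ t^r] = [x, y] ⊗ t^{m+r}`. -/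
def lieLoop : Loop N 𝔤 →ₗ[ℂ] Loop N 𝔤 →ₗ[ℂ] Loop N 𝔤 :=
  bilinLoop fun m r => (LieModule.toEnd ℂ 𝔤 𝔤 : 𝔤 →ₗ[ℂ] Module.End ℂ 𝔤).compr₂ (tens (m + r))

/-! ### The space of 1-forms modulo exact forms -/

/-- The relations `∑ p, m_p t^m k_p = 0`; here `Finsupp.single m v` stands for
`∑ p, v_p t^m k_p`, where `k_p = t_p⁻¹ d t_p`. -/
def exactForms : Submodule ℂ (Deg N →₀ (Fin (N + 1) → ℂ)) :=
  Submodule.span ℂ (Set.range fun m : Deg N => Finsupp.single m fun p => (m p : ℂ))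

/-- The space of 1-forms on the torus modulo exact forms. -/
abbrev Forms : Type := (Deg N →₀ (Fin (N + 1) → ℂ)) ⧸ exactForms N

variable {N} in
/-- The class of `∑ p, v_p t^m k_p`. -/
def form (m : Deg N) : (Fin (N + 1) → ℂ) →ₗ[ℂ] Forms N :=
  (exactForms N).mkQ ∘ₗ Finsupp.lsingle m

variable {N} in
theorem form_exact (m : Deg N) : form m (fun p => (m p : ℂ)) = 0 := by
  simp only [form, LinearMap.comp_apply, Submodule.mkQ_apply, Finsupp.lsingle_apply]
  exact (Submodule.Quotient.mk_eq_zero _).2 (Submodule.subset_span ⟨m, rfl⟩)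

variable {N} in
theorem form_ext {M : Type*} [AddCommGroup M] [Module ℂ M] {φ ψ : Forms N →ₗ[ℂ] M}
    (h : ∀ m v, φ (form m v) = ψ (form m v)) : φ = ψ := by
  apply Submodule.linearMap_qext
  apply Finsupp.lhom_ext
  intro m v
  exact h m v

/-- The 2-cocycle `(x ⊗ f, y ⊗ g) ↦ (x, y) g df`, with `(x, y)` the Killing form of `𝔤`;
on monomials, `t^r d(t^m) = ∑ p, m_p t^{m+r} k_p`. -/
def cocycle : Loop N 𝔤 →ₗ[ℂ] Loop N 𝔤 →ₗ[ℂ] Forms N :=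
  bilinLoop fun m r => (killingForm ℂ 𝔤).compr₂
    (LinearMap.toSpanSingleton ℂ (Forms N) (form (m + r) fun p => (m p : ℂ)))

variable {N 𝔤}

theorem lieLoop_tens (m r : Deg N) (x y : 𝔤) :
    lieLoop N 𝔤 (tens m x) (tens r y) = tens (m + r) ⁅x, y⁆ := by
  rw [lieLoop, bilinLoop_tens]; rfl

theorem cocycle_tens (m r : Deg N) (x y : 𝔤) :
    cocycle N 𝔤 (tens m x) (tens r y) =
      killingForm ℂ 𝔤 x y • form (m + r) fun p => (m p : ℂ) := by
  rw [cocycle, bilinLoop_tens]; rfl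

theorem lieLoop_skew (f g : Loop N 𝔤) : lieLoop N 𝔤 f g + lieLoop N 𝔤 g f = 0 := by
  induction f using loop_induction with
  | h0 => simp
  | hadd f f' h h' =>
    simp only [map_add, LinearMap.add_apply]
    rw [add_add_add_comm, h, h', add_zero]
  | h1 m x =>
    induction g using loop_induction with
    | h0 => simp
    | hadd f f' h h' =>
      simp only [map_add, LinearMap.add_apply]
      rw [add_add_add_comm, h, h', add_zero]
    | h1 r y =>
      rw [lieLoop_tens, lieLoop_tens, add_comm r m, ← map_add, ← lie_skew x y, neg_add_cancel,
        map_zero]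

theorem lieLoop_self (f : Loop N 𝔤) : lieLoop N 𝔤 f f = 0 := by
  have h := lieLoop_skew f f
  rw [← two_smul ℂ] at h
  exact (smul_eq_zero.1 h).resolve_left two_ne_zero

theorem lieLoop_jacobi (f g h : Loop N 𝔤) :
    lieLoop N 𝔤 f (lieLoop N 𝔤 g h) =
      lieLoop N 𝔤 (lieLoop N 𝔤 f g) h + lieLoop N 𝔤 g (lieLoop N 𝔤 f h) := by
  induction f using loop_induction with
  | h0 => simp
  | hadd f f' e e' => simp only [map_add, LinearMap.add_apply, e, e']; abel
  | h1 m x =>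
  induction g using loop_induction with
  | h0 => simp
  | hadd f f' e e' => simp only [map_add, LinearMap.add_apply, e, e']; abel
  | h1 r y =>
  induction h using loop_induction with
  | h0 => simp
  | hadd f f' e e' => simp only [map_add, e, e']; abel
  | h1 s z =>
    simp only [lieLoop_tens]
    rw [leibniz_lie, map_add, show r + (m + s) = m + (r + s) by abel, add_assoc m r s]

theorem cocycle_skew (f g : Loop N 𝔤) : cocycle N 𝔤 f g + cocycle N 𝔤 g f = 0 := by
  induction f using loop_induction with
  | h0 => simp
  | hadd f f' h h' =>
    simp only [map_add, LinearMap.add_apply]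
    rw [add_add_add_comm, h, h', add_zero]
  | h1 m x =>
    induction g using loop_induction with
    | h0 => simp
    | hadd f f' h h' =>
      simp only [map_add, LinearMap.add_apply]
      rw [add_add_add_comm, h, h', add_zero]
    | h1 r y =>
      rw [cocycle_tens, cocycle_tens, LieModule.traceForm_comm ℂ 𝔤 𝔤 y x, add_comm r m,
        ← smul_add, ← map_add]
      have : ((fun p => (m p : ℂ)) + fun p => (r p : ℂ)) = fun p => ((m + r) p : ℂ) := by
        ext p; simp
      rw [this, form_exact, smul_zero]

theorem cocycle_self (f : Loop N 𝔤) : cocycle N 𝔤 f f = 0 := by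
  have h := cocycle_skew f f
  rw [← two_smul ℂ] at h
  exact (smul_eq_zero.1 h).resolve_left two_ne_zero

theorem cocycle_jacobi (f g h : Loop N 𝔤) :
    cocycle N 𝔤 f (lieLoop N 𝔤 g h) =
      cocycle N 𝔤 (lieLoop N 𝔤 f g) h + cocycle N 𝔤 g (lieLoop N 𝔤 f h) := by
  induction f using loop_induction with
  | h0 => simp
  | hadd f f' e e' => simp only [map_add, LinearMap.add_apply, e, e']; abel
  | h1 m x =>
  induction g using loop_induction with
  | h0 => simp
  | hadd f f' e e' => simp only [map_add, LinearMap.add_apply, e, e']; abel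
  | h1 r y =>
  induction h using loop_induction with
  | h0 => simp
  | hadd f f' e e' => simp only [map_add, e, e']; abel
  | h1 s z =>
    simp only [lieLoop_tens, cocycle_tens]
    rw [LieModule.traceForm_apply_lie_apply, LieModule.traceForm_apply_lie_apply' ℂ 𝔤 𝔤 x y z |>
      fun e => (neg_eq_iff_eq_neg.2 e).symm, LieModule.traceForm_apply_lie_apply,
      show r + (m + s) = m + (r + s) by abel, show m + r + s = m + (r + s) by abel,
      neg_smul, ← sub_eq_add_neg, ← smul_sub, ← map_sub]
    congr 2
    ext p; simp

/-! ### The degree derivations -/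

/-- The derivation `∑ p, a_p d_p` of the multi-loop algebra, where `d_p = t_p ∂/∂t_p`. -/
def degLoop : (Fin (N + 1) → ℂ) →ₗ[ℂ] Loop N 𝔤 →ₗ[ℂ] Loop N 𝔤 :=
  LinearMap.mk₂ ℂ
    (fun a f => Finsupp.lsum ℂ (fun m : Deg N => (∑ p, a p * m p) • (tens m : 𝔤 →ₗ[ℂ] _)) f)
    (by
      intro a b f
      rw [← LinearMap.add_apply]
      congr 1
      ext m v : 2
      simp [add_mul, Finset.sum_add_distrib, add_smul])
    (by
      intro c a f
      rw [← LinearMap.smul_apply]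
      congr 1
      ext m v : 2
      simp [mul_assoc, ← Finset.mul_sum, mul_smul])
    (by intros; simp only [map_add]) (by intros; simp only [map_smul])

theorem degLoop_tens (a : Fin (N + 1) → ℂ) (m : Deg N) (x : 𝔤) :
    degLoop a (tens m x) = (∑ p, a p * m p) • tens m x := by
  simp [degLoop, tens]

/-- The action of `∑ p, a_p d_p` on forms, `[d_p, t^r k_i] = r_p t^r k_i`. -/
def degForms : (Fin (N + 1) → ℂ) →ₗ[ℂ] Forms N →ₗ[ℂ] Forms N :=
  LinearMap.mk₂ ℂ
    (fun a κ => (exactForms N).liftQ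
      (Finsupp.lsum ℂ fun r : Deg N => (∑ p, a p * r p) • form r)
      (by
        refine Submodule.span_le.2 ?_
        rintro _ ⟨m, rfl⟩
        simp [form_exact]) κ)
    (by
      intro a b κ
      rw [← LinearMap.add_apply]
      congr 1
      apply form_ext
      intro m v
      simp [form, add_mul, Finset.sum_add_distrib, add_smul])
    (by
      intro c a κ
      rw [← LinearMap.smul_apply]
      congr 1
      apply form_ext
      intro m v
      simp [form, mul_assoc, ← Finset.mul_sum, mul_smul])
    (by intros; simp) (by intros; simp)

theorem degForms_form (a : Fin (N + 1) → ℂ) (r : Deg N) (v : Fin (N + 1) → ℂ) :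
    degForms a (form r v) = (∑ p, a p * r p) • form r v := by
  simp [degForms, form]

theorem degLoop_lie (a : Fin (N + 1) → ℂ) (f g : Loop N 𝔤) :
    degLoop a (lieLoop N 𝔤 f g) =
      lieLoop N 𝔤 (degLoop a f) g + lieLoop N 𝔤 f (degLoop a g) := by
  induction f using loop_induction with
  | h0 => simp
  | hadd f f' e e' => simp only [map_add, LinearMap.add_apply, e, e']; abel
  | h1 m x =>
  induction g using loop_induction with
  | h0 => simp
  | hadd f f' e e' => simp only [map_add, e, e']; abel
  | h1 r y =>
    simp only [lieLoop_tens, degLoop_tens, map_smul, LinearMap.smul_apply, ← add_smul]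
    simp [mul_add, Finset.sum_add_distrib]

theorem degLoop_comm (a b : Fin (N + 1) → ℂ) (f : Loop N 𝔤) :
    degLoop a (degLoop b f) = degLoop b (degLoop a f) := by
  induction f using loop_induction with
  | h0 => simp
  | hadd f f' e e' => simp only [map_add, e, e']
  | h1 m x => simp only [degLoop_tens, map_smul, smul_smul, mul_comm]

theorem degForms_comm (a b : Fin (N + 1) → ℂ) (κ : Forms N) :
    degForms a (degForms b κ) = degForms b (degForms a κ) := by
  have : degForms a ∘ₗ degForms b = degForms b ∘ₗ degForms (N := N) a := by
    apply form_ext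
    intro m v
    simp only [LinearMap.comp_apply, degForms_form, map_smul, smul_smul, mul_comm]
  exact LinearMap.congr_fun this κ

theorem degForms_cocycle (a : Fin (N + 1) → ℂ) (f g : Loop N 𝔤) :
    degForms a (cocycle N 𝔤 f g) = cocycle N 𝔤 (degLoop a f) g + cocycle N 𝔤 f (degLoop a g) := by
  induction f using loop_induction with
  | h0 => simp
  | hadd f f' e e' => simp only [map_add, LinearMap.add_apply, e, e']; abel
  | h1 m x =>
  induction g using loop_induction with
  | h0 => simp
  | hadd f f' e e' => simp only [map_add, e, e']; abel
  | h1 r y =>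
    simp only [cocycle_tens, degLoop_tens, map_smul, LinearMap.smul_apply, degForms_form,
      smul_smul, ← add_smul]
    congr 1
    simp [mul_add, Finset.sum_add_distrib]
    ring

/-! ### The toroidal Lie algebra with degree derivations -/

variable (N 𝔤) in
/-- The Lie algebra `𝔤 ⊗ ℂ[t^{±1}] ⊕ (Ω¹/d) ⊕ ⨁ ℂ d_j`: the `(N+1)`-toroidal Lie algebra of `𝔤`
together with the degree derivations.  The triple `(f, κ, a)` stands for `f + κ + ∑ j, a_j d_j`. -/
def Algebra : Type := Loop N 𝔤 × Forms N × (Fin (N + 1) → ℂ)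

instance : AddCommGroup (Algebra N 𝔤) :=
  inferInstanceAs (AddCommGroup (Loop N 𝔤 × Forms N × (Fin (N + 1) → ℂ)))

instance : Module ℂ (Algebra N 𝔤) :=
  inferInstanceAs (Module ℂ (Loop N 𝔤 × Forms N × (Fin (N + 1) → ℂ)))

namespace Algebra

/-- The component in the multi-loop algebra. -/
def loop : Algebra N 𝔤 →ₗ[ℂ] Loop N 𝔤 := LinearMap.fst ℂ _ _

/-- The component in the space of 1-forms modulo exact forms. -/
def cen : Algebra N 𝔤 →ₗ[ℂ] Forms N := LinearMap.fst ℂ _ _ ∘ₗ LinearMap.snd ℂ _ _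

/-- The coefficients of the degree derivations `d_0, …, d_N`. -/
def der : Algebra N 𝔤 →ₗ[ℂ] (Fin (N + 1) → ℂ) := LinearMap.snd ℂ _ _ ∘ₗ LinearMap.snd ℂ _ _

/-- The element with given components. -/
def mk (f : Loop N 𝔤) (κ : Forms N) (a : Fin (N + 1) → ℂ) : Algebra N 𝔤 := (f, κ, a)

@[simp] theorem loop_mk (f : Loop N 𝔤) (κ : Forms N) (a : Fin (N + 1) → ℂ) :
    loop (mk f κ a) = f := rfl
@[simp] theorem cen_mk (f : Loop N 𝔤) (κ : Forms N) (a : Fin (N + 1) → ℂ) :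
    cen (mk f κ a) = κ := rfl
@[simp] theorem der_mk (f : Loop N 𝔤) (κ : Forms N) (a : Fin (N + 1) → ℂ) :
    der (mk f κ a) = a := rfl

@[ext] theorem ext {x y : Algebra N 𝔤} (h1 : loop x = loop y) (h2 : cen x = cen y)
    (h3 : der x = der y) : x = y :=
  Prod.ext h1 (Prod.ext h2 h3)

instance : Bracket (Algebra N 𝔤) (Algebra N 𝔤) where
  bracket x y := mk
    (lieLoop N 𝔤 (loop x) (loop y) + degLoop (der x) (loop y) - degLoop (der y) (loop x))
    (cocycle N 𝔤 (loop x) (loop y) + degForms (der x) (cen y) - degForms (der y) (cen x))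
    0

theorem loop_lie (x y : Algebra N 𝔤) :
    loop ⁅x, y⁆ = lieLoop N 𝔤 (loop x) (loop y) + degLoop (der x) (loop y) - degLoop (der y) (loop x) := rfl

theorem cen_lie (x y : Algebra N 𝔤) :
    cen ⁅x, y⁆ =
      cocycle N 𝔤 (loop x) (loop y) + degForms (der x) (cen y) - degForms (der y) (cen x) := rfl

theorem der_lie (x y : Algebra N 𝔤) : der ⁅x, y⁆ = 0 := rfl

instance : LieRing (Algebra N 𝔤) where
  add_lie x y z := by
    ext1 <;> simp only [map_add, loop_lie, cen_lie, der_lie, LinearMap.add_apply,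
      add_zero] <;> abel
  lie_add x y z := by
    ext1 <;> simp only [map_add, loop_lie, cen_lie, der_lie, LinearMap.add_apply,
      add_zero] <;> abel
  lie_self x := by
    ext1 <;> simp [loop_lie, cen_lie, der_lie, cocycle_self, lieLoop_self]
  leibniz_lie x y z := by
    ext1
    · simp only [map_add, map_sub, loop_lie, der_lie, LinearMap.zero_apply, map_zero, add_zero,
        sub_zero, LinearMap.add_apply, LinearMap.sub_apply, degLoop_lie, degLoop_comm (der x) (der y),
        degLoop_comm (der z) (der x), degLoop_comm (der z) (der y),
        lieLoop_jacobi (loop x) (loop y) (loop z)]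
      rw [eq_neg_of_add_eq_zero_left (lieLoop_skew (degLoop (der z) (loop x)) (loop y))]
      abel
    · simp only [map_add, map_sub, cen_lie, loop_lie, der_lie, LinearMap.zero_apply, map_zero,
        add_zero, sub_zero, LinearMap.add_apply, LinearMap.sub_apply, degForms_cocycle,
        degForms_comm (der x) (der y), degForms_comm (der z) (der x),
        degForms_comm (der z) (der y), cocycle_jacobi (loop x) (loop y) (loop z)]
      have h := eq_neg_of_add_eq_zero_left (cocycle_skew (degLoop (der z) (loop x)) (loop y))
      rw [h]
      abel
    · simp [der_lie]

instance : LieAlgebra ℂ (Algebra N 𝔤) where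
  lie_smul c x y := by
    ext1
    · simp only [map_smul, loop_lie, LinearMap.smul_apply, smul_add, smul_sub]
    · simp only [map_smul, cen_lie, LinearMap.smul_apply, smul_add, smul_sub]
    · simp [der_lie]

end Algebra

/-! ### Families of commuting finite order automorphisms and the twisted algebra -/

variable (N 𝔤) in
/-- A family `σ_0, …, σ_N` of automorphisms of `𝔤` of finite order that are simultaneously
diagonalizable, i.e. that commute with each other. -/
structure Family where
  σ : Fin (N + 1) → 𝔤 ≃ₗ⁅ℂ⁆ 𝔤
  finite : ∀ j, IsOfFinOrder ((σ j : 𝔤 →ₗ[ℂ] 𝔤) : Module.End ℂ 𝔤)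
  comm : ∀ i j x, σ i (σ j x) = σ j (σ i x)

namespace Family

variable (S : Family N 𝔤)

/-- The order `n_j` of `σ_j`. -/
def order (j : Fin (N + 1)) : ℕ := orderOf ((S.σ j : 𝔤 →ₗ[ℂ] 𝔤) : Module.End ℂ 𝔤)

/-- The root of unity `ε_j = exp (2πi / n_j)`. -/
def root (j : Fin (N + 1)) : ℂ := Complex.exp (2 * Real.pi * Complex.I / S.order j)

theorem root_ne_zero (j : Fin (N + 1)) : S.root j ≠ 0 := Complex.exp_ne_zero _

/-- The joint eigenspace of all `x` with `σ_j x = ε_j ^ m_j x`; it depends only on the classes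
of the `m_j` modulo `n_j`. -/
def eigen (m : Deg N) : Submodule ℂ 𝔤 where
  carrier := {x | ∀ j, S.σ j x = S.root j ^ m j • x}
  add_mem' hx hy j := by rw [map_add, hx j, hy j, smul_add]
  zero_mem' j := by simp
  smul_mem' c x hx j := by rw [map_smul, hx j, smul_comm]

theorem mem_eigen {m : Deg N} {x : 𝔤} : x ∈ S.eigen m ↔ ∀ j, S.σ j x = S.root j ^ m j • x :=
  Iff.rfl

theorem lie_mem_eigen {m r : Deg N} {x y : 𝔤} (hx : x ∈ S.eigen m) (hy : y ∈ S.eigen r) :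
    ⁅x, y⁆ ∈ S.eigen (m + r) := by
  intro j
  rw [LieEquiv.map_lie, hx j, hy j, smul_lie, lie_smul, smul_smul, Pi.add_apply,
    zpow_add₀ (S.root_ne_zero j)]

/-- The subalgebra of fixed points, which is the joint eigenspace of degree `(0, …, 0)`. -/
def fixed : LieSubalgebra ℂ 𝔤 where
  __ := S.eigen 0
  lie_mem' hx hy := by simpa using S.lie_mem_eigen hx hy

/-- `⨁_m 𝔤_m ⊗ t^m`. -/
def loopPart : Submodule ℂ (Loop N 𝔤) :=
  Submodule.span ℂ {f | ∃ (m : Deg N) (x : 𝔤), x ∈ S.eigen m ∧ f = tens m x}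

/-- The span of the `t_0^{n_0 m_0} ⋯ t_N^{n_N m_N} k_i`. -/
def formsPart : Submodule ℂ (Forms N) :=
  Submodule.span ℂ {κ | ∃ (m : Deg N) (i : Fin (N + 1)),
    κ = form (fun j => (S.order j : ℤ) * m j) (Pi.single i 1)}

theorem form_mem_formsPart {r : Deg N} (hr : ∀ j, (S.order j : ℤ) ∣ r j) (v : Fin (N + 1) → ℂ) :
    form r v ∈ S.formsPart := by
  choose m hm using hr
  have hr' : r = fun j => (S.order j : ℤ) * m j := funext hm
  have hv : v = ∑ i, v i • (Pi.single i 1 : Fin (N + 1) → ℂ) := by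
    ext j; simp [Finset.sum_apply, Pi.single_apply]
  rw [hv, map_sum]
  refine Submodule.sum_mem _ fun i _ => ?_
  rw [map_smul]
  exact Submodule.smul_mem _ _ (Submodule.subset_span ⟨m, i, by rw [hr']⟩)

theorem dvd_of_killing_ne_zero {m r : Deg N} {x y : 𝔤} (hx : x ∈ S.eigen m) (hy : y ∈ S.eigen r)
    (h : killingForm ℂ 𝔤 x y ≠ 0) (j : Fin (N + 1)) : (S.order j : ℤ) ∣ (m + r) j := by
  have h1 : killingForm ℂ 𝔤 (S.σ j x) (S.σ j y) = killingForm ℂ 𝔤 x y :=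
    LieAlgebra.killingForm_of_equiv_apply (S.σ j) x y
  rw [hx j, hy j, map_smul, map_smul, LinearMap.smul_apply, smul_smul, smul_eq_mul,
    ← zpow_add₀ (S.root_ne_zero j)] at h1
  have h2 : S.root j ^ (r j + m j) = 1 := mul_right_cancel₀ h (by simpa using h1)
  have h3 : IsPrimitiveRoot (S.root j) (S.order j) :=
    Complex.isPrimitiveRoot_exp _ (S.finite j).orderOf_pos.ne'
  rw [Pi.add_apply, add_comm]
  exact (h3.zpow_eq_one_iff_dvd _).1 h2

theorem lie_mem_loopPart {f g : Loop N 𝔤} (hf : f ∈ S.loopPart) (hg : g ∈ S.loopPart) :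
    lieLoop N 𝔤 f g ∈ S.loopPart := by
  induction hf using Submodule.span_induction with
  | zero => simp
  | add f f' _ _ h h' => rw [map_add, LinearMap.add_apply]; exact add_mem h h'
  | smul c f _ h => rw [map_smul, LinearMap.smul_apply]; exact Submodule.smul_mem _ _ h
  | mem f hf =>
  induction hg using Submodule.span_induction with
  | zero => simp
  | add f f' _ _ h h' => rw [map_add]; exact add_mem h h'
  | smul c f _ h => rw [map_smul]; exact Submodule.smul_mem _ _ h
  | mem g hg =>
    obtain ⟨m, x, hx, rfl⟩ := hf
    obtain ⟨r, y, hy, rfl⟩ := hg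
    rw [lieLoop_tens]
    exact Submodule.subset_span ⟨_, _, S.lie_mem_eigen hx hy, rfl⟩

theorem degLoop_mem_loopPart (a : Fin (N + 1) → ℂ) {f : Loop N 𝔤} (hf : f ∈ S.loopPart) :
    degLoop a f ∈ S.loopPart := by
  induction hf using Submodule.span_induction with
  | zero => simp
  | add f f' _ _ h h' => rw [map_add]; exact add_mem h h'
  | smul c f _ h => rw [map_smul]; exact Submodule.smul_mem _ _ h
  | mem f hf =>
    obtain ⟨m, x, hx, rfl⟩ := hf
    rw [degLoop_tens]
    exact Submodule.smul_mem _ _ (Submodule.subset_span ⟨m, x, hx, rfl⟩)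

theorem degForms_mem_formsPart (a : Fin (N + 1) → ℂ) {κ : Forms N} (hκ : κ ∈ S.formsPart) :
    degForms a κ ∈ S.formsPart := by
  induction hκ using Submodule.span_induction with
  | zero => simp
  | add f f' _ _ h h' => rw [map_add]; exact add_mem h h'
  | smul c f _ h => rw [map_smul]; exact Submodule.smul_mem _ _ h
  | mem κ hκ =>
    obtain ⟨m, i, rfl⟩ := hκ
    rw [degForms_form]
    exact Submodule.smul_mem _ _ (Submodule.subset_span ⟨m, i, rfl⟩)

theorem cocycle_mem_formsPart {f g : Loop N 𝔤} (hf : f ∈ S.loopPart) (hg : g ∈ S.loopPart) :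
    cocycle N 𝔤 f g ∈ S.formsPart := by
  induction hf using Submodule.span_induction with
  | zero => simp
  | add f f' _ _ h h' => rw [map_add, LinearMap.add_apply]; exact add_mem h h'
  | smul c f _ h => rw [map_smul, LinearMap.smul_apply]; exact Submodule.smul_mem _ _ h
  | mem f hf =>
  induction hg using Submodule.span_induction with
  | zero => simp
  | add f f' _ _ h h' => rw [map_add]; exact add_mem h h'
  | smul c f _ h => rw [map_smul]; exact Submodule.smul_mem _ _ h
  | mem g hg =>
    obtain ⟨m, x, hx, rfl⟩ := hf
    obtain ⟨r, y, hy, rfl⟩ := hg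
    rw [cocycle_tens]
    by_cases h : killingForm ℂ 𝔤 x y = 0
    · rw [h, zero_smul]; exact zero_mem _
    · exact Submodule.smul_mem _ _
        (S.form_mem_formsPart (S.dvd_of_killing_ne_zero hx hy h) _)

/-- The twisted toroidal Lie algebra (with the degree derivations `d_0, …, d_N`) of the family. -/
def twisted : LieSubalgebra ℂ (Algebra N 𝔤) where
  carrier := {x | Algebra.loop x ∈ S.loopPart ∧ Algebra.cen x ∈ S.formsPart}
  add_mem' hx hy := by
    simp only [Set.mem_ofPred_eq, map_add]
    exact ⟨add_mem hx.1 hy.1, add_mem hx.2 hy.2⟩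
  zero_mem' := by simp
  smul_mem' c x hx := by
    simp only [Set.mem_ofPred_eq, map_smul]
    exact ⟨Submodule.smul_mem _ _ hx.1, Submodule.smul_mem _ _ hx.2⟩
  lie_mem' {x y} hx hy := by
    simp only [Set.mem_ofPred_eq, Algebra.loop_lie, Algebra.cen_lie]
    exact ⟨sub_mem (add_mem (S.lie_mem_loopPart hx.1 hy.1) (S.degLoop_mem_loopPart _ hy.1))
        (S.degLoop_mem_loopPart _ hx.1),
      sub_mem (add_mem (S.cocycle_mem_formsPart hx.1 hy.1) (S.degForms_mem_formsPart _ hy.2))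
        (S.degForms_mem_formsPart _ hx.2)⟩

/-! ### Cartan subalgebra, roots and the bilinear form -/

variable (H : LieSubalgebra ℂ S.fixed)

/-- The space `𝔥 = H ⊕ ⨁ ℂ d_j ⊕ ⨁ ℂ k_j`; the triple `(h, a, b)` stands for
`h + ∑ j, a_j d_j + ∑ j, b_j k_j`. -/
abbrev Cartan : Type := H × (Fin (N + 1) → ℂ) × (Fin (N + 1) → ℂ)

/-- The inclusion of `𝔥` into the twisted algebra; `h` is sent to `h ⊗ 1`. -/
def incl : S.Cartan H →ₗ[ℂ] S.twisted where
  toFun h := ⟨Algebra.mk (tens 0 ((h.1 : S.fixed) : 𝔤)) (form 0 h.2.2) h.2.1,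
    Submodule.subset_span ⟨0, _, h.1.1.2, rfl⟩,
    S.form_mem_formsPart (fun j => by simp) _⟩
  map_add' x y := by
    apply Subtype.ext
    apply Algebra.ext <;> simp
  map_smul' c x := by
    apply Subtype.ext
    apply Algebra.ext <;> simp

/-- The root space of the linear form `α` on `𝔥`. -/
def rootSpace (α : Module.Dual ℂ (S.Cartan H)) : Submodule ℂ S.twisted where
  carrier := {x | ∀ h : S.Cartan H, ⁅S.incl H h, x⁆ = α h • x}
  add_mem' hx hy h := by rw [lie_add, hx h, hy h, smul_add]
  zero_mem' h := by simp
  smul_mem' c x hx h := by rw [lie_smul, hx h, smul_comm]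

/-- The extension of a linear form on `H` by zero on the `d_j` and the `k_j`. -/
def extend (l : Module.Dual ℂ H) : Module.Dual ℂ (S.Cartan H) := l ∘ₗ LinearMap.fst ℂ _ _

/-- The linear form `δ_j`, with `δ_j (d_i) = δ_{ij}`, zero on `H` and on the `k_i`. -/
def delta (j : Fin (N + 1)) : Module.Dual ℂ (S.Cartan H) :=
  LinearMap.proj j ∘ₗ LinearMap.fst ℂ _ _ ∘ₗ LinearMap.snd ℂ _ _

/-- The space `V` spanned by the linear forms on `H` and the `δ_j`. -/
def V : Submodule ℂ (Module.Dual ℂ (S.Cartan H)) :=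
  LinearMap.range (LinearMap.dualMap (LinearMap.fst ℂ H _)) ⊔
    Submodule.span ℂ (Set.range (S.delta H))

/-- The symmetric bilinear form on `𝔥`: the Killing form of `𝔤` on `H`, `(d_i, k_j) = δ_{ij}`, all
other products among the summands being zero. -/
def bilin : LinearMap.BilinForm ℂ (S.Cartan H) :=
  LinearMap.mk₂ ℂ
    (fun x y => killingForm ℂ 𝔤 ((x.1 : S.fixed) : 𝔤) ((y.1 : S.fixed) : 𝔤)
      + ∑ j, (x.2.1 j * y.2.2 j + x.2.2 j * y.2.1 j))
    (by intros; simp [add_mul, Finset.sum_add_distrib]; ring)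
    (by intros; simp [mul_add, mul_assoc, Finset.mul_sum])
    (by intros; simp [mul_add, Finset.sum_add_distrib]; ring)
    (by intros; simp [mul_add, mul_left_comm, Finset.mul_sum])

/-- The form on `𝔥*` carried over by the map `ν : h ↦ (h, ·)`, i.e. `(ν⁻¹ α, ν⁻¹ β)`
(meaningful when the form on `𝔥` is nondegenerate). -/
def dualForm (α β : Module.Dual ℂ (S.Cartan H)) : ℂ :=
  S.bilin H (Function.invFun (S.bilin H) α) (Function.invFun (S.bilin H) β)

/-- The set of non-isotropic roots in `V`. -/
def roots : Set (Module.Dual ℂ (S.Cartan H)) :=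
  {α | α ∈ S.V H ∧ S.rootSpace H α ≠ ⊥ ∧ S.dualForm H α α ≠ 0}

/-- The root system of the twisted algebra is `R`, where `R` is a set of vectors
`∑ i, x_i ε_i + ∑ j, k_j δ_j` with integral coordinates `(x, k)`, the `ε_i` being orthogonal of the
same positive square length and the `δ_j` spanning the radical.  This is required for every choice
of a Cartan subalgebra of the fixed point algebra. -/
def HasRootSystem {ℓ : ℕ} (R : Set ((Fin ℓ → ℤ) × (Fin (N + 1) → ℤ))) : Prop :=
  ∀ H : LieSubalgebra ℂ S.fixed, H.IsCartanSubalgebra →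
    (S.bilin H).Nondegenerate ∧
    ∃ (c : ℝ) (ε : Module.Basis (Fin ℓ) ℂ (Module.Dual ℂ H)), 0 < c ∧
      (∀ i j, S.dualForm H (S.extend H (ε i)) (S.extend H (ε j)) = if i = j then (c : ℂ) else 0) ∧
      S.roots H = (fun p : (Fin ℓ → ℤ) × (Fin (N + 1) → ℤ) =>
        ∑ i, (p.1 i : ℂ) • S.extend H (ε i) + ∑ j, (p.2 j : ℂ) • S.delta H j) '' R

end Family

/-! ### The root systems -/

/-- The short roots of `B_ℓ`: `± e_i`. -/
def shortB (ℓ : ℕ) : Set (Fin ℓ → ℤ) :=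
  {x | ∃ (i : Fin ℓ) (s : ℤˣ), x = Pi.single i (s : ℤ)}

/-- The long roots of `B_ℓ`: `± e_i ± e_j` with `i ≠ j`. -/
def longB (ℓ : ℕ) : Set (Fin ℓ → ℤ) :=
  {x | ∃ (i j : Fin ℓ) (s t : ℤˣ), i ≠ j ∧ x = Pi.single i (s : ℤ) + Pi.single j (t : ℤ)}

/-- The long roots of `C_ℓ`: `± 2 e_i`. -/
def longC (ℓ : ℕ) : Set (Fin ℓ → ℤ) :=
  {x | ∃ (i : Fin ℓ) (s : ℤˣ), x = Pi.single i (2 * (s : ℤ))}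

/-- The root system `R(B_ℓ)^{(2,…,2,1,…,1)}`, with `m + 1` entries `2` and `n - m` entries `1`. -/
def rootsB (ℓ m n : ℕ) : Set ((Fin ℓ → ℤ) × (Fin (n + 1) → ℤ)) :=
  {p | p.1 ∈ shortB ℓ} ∪
  {p | p.1 ∈ longB ℓ ∧ ∀ j : Fin (n + 1), j.val ≤ m → Even (p.2 j)}

/-- The root system `R(BC_ℓ)^{(2,…,2,1,…,1)}(2)`: the parity conditions are on
`k_1, …, k_{m+1}`, and `k_0` is odd for the roots that come from the long roots of `C_ℓ`. -/
def rootsBC (ℓ m n : ℕ) : Set ((Fin ℓ → ℤ) × (Fin (n + 1) → ℤ)) :=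
  {p | p.1 ∈ shortB ℓ} ∪
  {p | p.1 ∈ longB ℓ ∧ ∀ j : Fin (n + 1), 1 ≤ j.val → j.val ≤ m + 1 → Even (p.2 j)} ∪
  {p | p.1 ∈ longC ℓ ∧ Odd (p.2 0) ∧
    ∀ j : Fin (n + 1), 1 ≤ j.val → j.val ≤ m + 1 → Even (p.2 j)}

/-! ### The classical Lie algebras and their automorphisms -/

attribute [local instance 100] LieRing.ofAssociativeRing

/-- The `2ℓ + 2^{m+1}` matrix indices, as a block of `2ℓ` followed by a block of `2^{m+1}`. -/
abbrev Idx (ℓ m : ℕ) : Type := Fin (2 * ℓ) ⊕ Fin (2 ^ (m + 1))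

/-- The diagonal entries of `J_k`: `1` on the first block, while on the second block
`2^k` entries `1` alternate with `2^k` entries `-1`. -/
def signJ (ℓ m k : ℕ) : Idx ℓ m → ℂ :=
  Sum.elim (fun _ => 1) fun j => (-1) ^ (j.val / 2 ^ k)

theorem signJ_mul_self (ℓ m k : ℕ) (i : Idx ℓ m) : signJ ℓ m k i * signJ ℓ m k i = 1 := by
  rcases i with i | i
  · simp [signJ]
  · simp [signJ, ← mul_pow]

/-- The matrix `J_k`. -/
def J (ℓ m k : ℕ) : Matrix (Idx ℓ m) (Idx ℓ m) ℂ := Matrix.diagonal (signJ ℓ m k)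

theorem J_mul_self (ℓ m k : ℕ) : J ℓ m k * J ℓ m k = 1 := by
  rw [J, Matrix.diagonal_mul_diagonal, ← Matrix.diagonal_one]
  congr 1
  ext i
  exact signJ_mul_self ℓ m k i

theorem J_comm (ℓ m k k' : ℕ) : J ℓ m k * J ℓ m k' = J ℓ m k' * J ℓ m k := by
  simp only [J, Matrix.diagonal_mul_diagonal, mul_comm]

theorem J_transpose (ℓ m k : ℕ) : (J ℓ m k).transpose = J ℓ m k := Matrix.diagonal_transpose _

theorem J_inv (ℓ m k : ℕ) : (J ℓ m k)⁻¹ = J ℓ m k := Matrix.inv_eq_left_inv (J_mul_self ℓ m k)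

/-- The Lie algebra of type `D_{ℓ+2^m}`, as antisymmetric matrices of size `2ℓ + 2^{m+1}`. -/
abbrev so (ℓ m : ℕ) : LieSubalgebra ℂ (Matrix (Idx ℓ m) (Idx ℓ m) ℂ) :=
  LieAlgebra.Orthogonal.so (Idx ℓ m) ℂ

/-- The Lie algebra of type `A_{2ℓ+2^{m+1}-1}`, as traceless matrices of size `2ℓ + 2^{m+1}`. -/
abbrev sl (ℓ m : ℕ) : LieSubalgebra ℂ (Matrix (Idx ℓ m) (Idx ℓ m) ℂ) :=
  LieAlgebra.SpecialLinear.sl (Idx ℓ m) ℂ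

theorem mem_sl {ℓ m : ℕ} {X : Matrix (Idx ℓ m) (Idx ℓ m) ℂ} : X ∈ sl ℓ m ↔ X.trace = 0 := Iff.rfl

/-- `Ad(J_k)`, i.e. `X ↦ J_k X J_k⁻¹`, on all matrices. -/
def adJ (ℓ m k : ℕ) : Matrix (Idx ℓ m) (Idx ℓ m) ℂ ≃ₗ⁅ℂ⁆ Matrix (Idx ℓ m) (Idx ℓ m) ℂ :=
  Matrix.lieConj (J ℓ m k) ⟨J ℓ m k, J_mul_self ℓ m k, J_mul_self ℓ m k⟩

theorem adJ_apply (ℓ m k : ℕ) (X : Matrix (Idx ℓ m) (Idx ℓ m) ℂ) :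
    adJ ℓ m k X = J ℓ m k * X * J ℓ m k := by
  rw [adJ, Matrix.lieConj_apply, J_inv]

theorem adJ_adJ (ℓ m k : ℕ) (X : Matrix (Idx ℓ m) (Idx ℓ m) ℂ) :
    adJ ℓ m k (adJ ℓ m k X) = X := by
  rw [adJ_apply, adJ_apply, ← mul_assoc, ← mul_assoc, J_mul_self, one_mul, mul_assoc,
    J_mul_self, mul_one]

theorem adJ_comm (ℓ m k k' : ℕ) (X : Matrix (Idx ℓ m) (Idx ℓ m) ℂ) :
    adJ ℓ m k (adJ ℓ m k' X) = adJ ℓ m k' (adJ ℓ m k X) := by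
  simp only [adJ_apply]
  calc J ℓ m k * (J ℓ m k' * X * J ℓ m k') * J ℓ m k
      = (J ℓ m k * J ℓ m k') * X * (J ℓ m k' * J ℓ m k) := by simp only [mul_assoc]
    _ = (J ℓ m k' * J ℓ m k) * X * (J ℓ m k * J ℓ m k') := by rw [J_comm ℓ m k k']
    _ = _ := by simp only [mul_assoc]

theorem adJ_mem_so {ℓ m : ℕ} (k : ℕ) {X : Matrix (Idx ℓ m) (Idx ℓ m) ℂ} (hX : X ∈ so ℓ m) :
    adJ ℓ m k X ∈ so ℓ m := by
  rw [LieAlgebra.Orthogonal.mem_so] at hX ⊢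
  rw [adJ_apply, Matrix.transpose_mul, Matrix.transpose_mul, hX, J_transpose]
  simp [mul_assoc]

theorem adJ_mem_sl {ℓ m : ℕ} (k : ℕ) {X : Matrix (Idx ℓ m) (Idx ℓ m) ℂ} (hX : X ∈ sl ℓ m) :
    adJ ℓ m k X ∈ sl ℓ m := by
  rw [mem_sl] at hX ⊢
  rw [adJ_apply, Matrix.trace_mul_comm, ← mul_assoc, J_mul_self, one_mul, hX]

theorem map_adJ {ℓ m : ℕ} (k : ℕ) (L : LieSubalgebra ℂ (Matrix (Idx ℓ m) (Idx ℓ m) ℂ))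
    (hL : ∀ X ∈ L, adJ ℓ m k X ∈ L) : L.map (adJ ℓ m k : _ →ₗ⁅ℂ⁆ _) = L := by
  ext X
  rw [LieSubalgebra.mem_map]
  constructor
  · rintro ⟨Y, hY, rfl⟩
    exact hL Y hY
  · intro hX
    exact ⟨adJ ℓ m k X, hL X hX, adJ_adJ ℓ m k X⟩

/-- `Ad(J_k)` on antisymmetric matrices. -/
def adSo (ℓ m k : ℕ) : so ℓ m ≃ₗ⁅ℂ⁆ so ℓ m :=
  LieEquiv.ofSubalgebras _ _ (adJ ℓ m k) (map_adJ k _ fun _ => adJ_mem_so k)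

/-- `Ad(J_k)` on traceless matrices. -/
def adSl (ℓ m k : ℕ) : sl ℓ m ≃ₗ⁅ℂ⁆ sl ℓ m :=
  LieEquiv.ofSubalgebras _ _ (adJ ℓ m k) (map_adJ k _ fun _ => adJ_mem_sl k)

theorem coe_adSo {ℓ m : ℕ} (k : ℕ) (X : so ℓ m) :
    (adSo ℓ m k X : Matrix (Idx ℓ m) (Idx ℓ m) ℂ) = adJ ℓ m k X := rfl

theorem coe_adSl {ℓ m : ℕ} (k : ℕ) (X : sl ℓ m) :
    (adSl ℓ m k X : Matrix (Idx ℓ m) (Idx ℓ m) ℂ) = adJ ℓ m k X := rfl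

theorem neg_transpose_mem_sl {ℓ m : ℕ} {X : Matrix (Idx ℓ m) (Idx ℓ m) ℂ} (hX : X ∈ sl ℓ m) :
    -X.transpose ∈ sl ℓ m := by
  rw [mem_sl] at hX ⊢
  rw [Matrix.trace_neg, Matrix.trace_transpose, hX, neg_zero]

/-- The Cartan involution `X ↦ -Xᵀ` of the traceless matrices. -/
def cartanInvolution (ℓ m : ℕ) : sl ℓ m ≃ₗ⁅ℂ⁆ sl ℓ m where
  toFun X := ⟨-X.1.transpose, neg_transpose_mem_sl X.2⟩
  invFun X := ⟨-X.1.transpose, neg_transpose_mem_sl X.2⟩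
  map_add' X Y := by
    apply Subtype.ext
    simp [add_comm]
  map_smul' c X := by
    apply Subtype.ext
    simp
  map_lie' {X Y} := by
    apply Subtype.ext
    simp only [LieSubalgebra.coe_bracket, Ring.lie_def, Matrix.transpose_sub,
      Matrix.transpose_mul]
    noncomm_ring
  left_inv X := by
    apply Subtype.ext
    simp
  right_inv X := by
    apply Subtype.ext
    simp

theorem isOfFinOrder_of_involutive {L : Type} [LieRing L] [LieAlgebra ℂ L] (σ : L ≃ₗ⁅ℂ⁆ L)
    (h : ∀ x, σ (σ x) = x) : IsOfFinOrder ((σ : L →ₗ[ℂ] L) : Module.End ℂ L) := by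
  rw [isOfFinOrder_iff_pow_eq_one]
  refine ⟨2, two_pos, ?_⟩
  ext x
  exact h x

theorem adSo_involutive {ℓ m : ℕ} (k : ℕ) (X : so ℓ m) : adSo ℓ m k (adSo ℓ m k X) = X :=
  Subtype.ext (by rw [coe_adSo, coe_adSo, adJ_adJ])

theorem adSl_involutive {ℓ m : ℕ} (k : ℕ) (X : sl ℓ m) : adSl ℓ m k (adSl ℓ m k X) = X :=
  Subtype.ext (by rw [coe_adSl, coe_adSl, adJ_adJ])

theorem adSo_comm {ℓ m : ℕ} (k k' : ℕ) (X : so ℓ m) :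
    adSo ℓ m k (adSo ℓ m k' X) = adSo ℓ m k' (adSo ℓ m k X) :=
  Subtype.ext (by rw [coe_adSo, coe_adSo, coe_adSo, coe_adSo, adJ_comm])

theorem adSl_comm {ℓ m : ℕ} (k k' : ℕ) (X : sl ℓ m) :
    adSl ℓ m k (adSl ℓ m k' X) = adSl ℓ m k' (adSl ℓ m k X) :=
  Subtype.ext (by rw [coe_adSl, coe_adSl, coe_adSl, coe_adSl, adJ_comm])

theorem cartanInvolution_adSl {ℓ m : ℕ} (k : ℕ) (X : sl ℓ m) :
    cartanInvolution ℓ m (adSl ℓ m k X) = adSl ℓ m k (cartanInvolution ℓ m X) := by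
  apply Subtype.ext
  rw [coe_adSl]
  change -(adJ ℓ m k X.1).transpose = adJ ℓ m k (-X.1.transpose)
  rw [adJ_apply, adJ_apply, Matrix.transpose_mul, Matrix.transpose_mul, J_transpose]
  simp [mul_assoc]

/-- The family `Ad(J_0), …, Ad(J_m), id, …, id` on the Lie algebra of type `D_{ℓ+2^m}`. -/
def familyD (ℓ m n : ℕ) : Family n (so ℓ m) where
  σ k := if k.val ≤ m then adSo ℓ m k.val else LieEquiv.refl
  finite k := by
    apply isOfFinOrder_of_involutive
    intro X
    split_ifs
    · exact adSo_involutive _ X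
    · rfl
  comm i j X := by
    split_ifs
    · exact adSo_comm _ _ X
    all_goals rfl

/-- The family `σ_0, Ad(J_0), …, Ad(J_m), id, …, id` on the Lie algebra of type
`A_{2ℓ+2^{m+1}-1}`, where `σ_0` is the Cartan involution. -/
def familyA (ℓ m n : ℕ) : Family n (sl ℓ m) where
  σ k := if k.val = 0 then cartanInvolution ℓ m
    else if k.val ≤ m + 1 then adSl ℓ m (k.val - 1) else LieEquiv.refl
  finite k := by
    apply isOfFinOrder_of_involutive
    intro X
    split_ifs
    · exact (cartanInvolution ℓ m).left_inv X
    · exact adSl_involutive _ X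
    · rfl
  comm i j X := by
    split_ifs
    · rfl
    · exact cartanInvolution_adSl _ X
    · rfl
    · exact (cartanInvolution_adSl _ X).symm
    · exact adSl_comm _ _ X
    all_goals rfl

end Toroidal

end

/-!
Both fixed point algebras `𝔤_0` are the same Lie algebra: antisymmetric matrices that commute with
all `J_k`. The signs `(-1)^⌊j/2^k⌋`, `k ≤ m`, are given by the binary digits of `j`, so distinct
indices of the second block have distinct signs, only its index `0` has the signs of the first
block, and these matrices are supported on a block of size `2ℓ + 1` (`apply_inr_eq_zero`). Thus
`𝔤_0 = so(2ℓ + 1)`.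

A Cartan subalgebra `H` of `so(2ℓ + 1)` is arbitrary, and its normal form is found without the
conjugacy theorem. Decompose the natural representation `U` into generalized weight spaces of the
nilpotent algebra `H`. The operators `w ↦ B(v, w) u - B(u, w) v` with `u`, `v` in opposite weight
spaces have weight zero, so they belong to `H`, since a Cartan subalgebra is its own zero weight
space in the adjoint representation. In a nilpotent algebra there is no relation `[x, y] = c y`
with `c, y ≠ 0`, which forces every weight space of nonzero weight to be a line
(`IsOrthogonalRep.eq_smul_of_mem`), and the zero weight space, which has odd dimension, to be an
anisotropic line (`IsOrthogonalRep.exists_zero_weight_vector`). Counting dimensions, `U` has a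
hyperbolic basis of weight vectors of weights `±ε_1, …, ±ε_ℓ, 0`, and the `ε_i` are a basis of `H*`
(`IsOrthogonalRep.exists_hyperbolic_basis`, `exists_isHyperbolicBasis`). Together with the
remaining standard basis vectors this is a basis of the whole space that diagonalizes `H` and all
`J_k`.

In this basis, a matrix unit with labels `b`, `c` has the weight `wt b - wt c` and is multiplied by
`sgn k b * sgn k c` under `Ad(J_k)`, while `X ↦ -Xᵀ` permutes the matrix units up to sign, by a
reflection that fixes those with opposite labels. Reading off an entry of a weight vector, and
symmetrizing matrix units, give the weights of `H` on every joint eigenspace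
(`IsHyperbolicBasis.weight_iff`). The differences of weights are the roots of `BC_ℓ`: short roots
involve a label of weight zero, whose signs are arbitrary; the other roots have trivial signs, and
the roots `±2ε_i` belong to opposite labels, so they need symmetric matrices, i.e. an odd degree in
`t_0` for `sl` and never for `so`.

On the side of the toroidal algebra, a root with a nonzero component on `H` can only be carried by
`𝔤 ⊗ ℛ`, hence it is a weight of `H` on a joint eigenspace, shifted by the degree
(`Family.rootSpace_ne_bot_iff`), and the Killing forms of `so` and `sl` are positive multiples of
the trace form (`killingForm_so`, `killingForm_sl`). So the form on `𝔥` is nondegenerate, the `ε_i`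
are orthogonal of equal positive square length, and the nonisotropic roots are those with a nonzero
component on `H` (`Family.hasRootSystem_of_weights`).
-/

noncomputable section

namespace Toroidal

/-! ### Cartan subalgebras of orthogonal Lie algebras -/

section

open LieModule Module

/-- If `F` acts on the values of a bilinear map `g` as a derivation built from `f₁` and `f₂`, then
`g` pairs vectors killed by powers of `f₁` and `f₂` to vectors killed by a power of `F`. -/
theorem pow_apply_bilin_eq_zero {M₁ M₂ M₃ : Type*} [AddCommGroup M₁] [Module ℂ M₁]
    [AddCommGroup M₂] [Module ℂ M₂] [AddCommGroup M₃] [Module ℂ M₃]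
    (g : M₁ →ₗ[ℂ] M₂ →ₗ[ℂ] M₃) (f₁ : End ℂ M₁) (f₂ : End ℂ M₂) (F : End ℂ M₃)
    (hF : ∀ u v, F (g u v) = g (f₁ u) v + g u (f₂ v)) (n : ℕ) :
    ∀ k l u v, k + l = n → (f₁ ^ k) u = 0 → (f₂ ^ l) v = 0 → (F ^ n) (g u v) = 0 := by
  induction n with
  | zero =>
    intro k l u v hn hu hv
    obtain rfl : k = 0 := by omega
    have : u = 0 := by simpa using hu
    simp [this]
  | succ n ih =>
    intro k l u v hn hu hv
    rw [pow_succ, Module.End.mul_apply, hF, map_add]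
    have h1 : (F ^ n) (g (f₁ u) v) = 0 := by
      rcases k with _ | k
      · have : u = 0 := by simpa using hu
        simp [this]
      · exact ih k l _ _ (by omega) (by rwa [pow_succ, Module.End.mul_apply] at hu) hv
    have h2 : (F ^ n) (g u (f₂ v)) = 0 := by
      rcases l with _ | l
      · have : v = 0 := by simpa using hv
        simp [this]
      · exact ih k l _ _ (by omega) hu (by rwa [pow_succ, Module.End.mul_apply] at hv)
    rw [h1, h2, add_zero]

/-- A representation of a Lie algebra `L` that identifies `L` with the orthogonal Lie algebra of
the nondegenerate symmetric bilinear form `B`: it is faithful, `L` acts by skew operators, and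
every operator `w ↦ B(v, w) u - B(u, w) v` is the action of an element `S u v` of `L`. -/
structure IsOrthogonalRep {L U : Type*} [LieRing L] [LieAlgebra ℂ L] [AddCommGroup U] [Module ℂ U]
    [LieRingModule L U] [LieModule ℂ L U]
    (B : LinearMap.BilinForm ℂ U) (S : U →ₗ[ℂ] U →ₗ[ℂ] L) : Prop where
  symm : ∀ u v, B u v = B v u
  nondeg : ∀ u, (∀ v, B u v = 0) → u = 0
  skew : ∀ (x : L) u v, B ⁅x, u⁆ v = -B u ⁅x, v⁆
  rankTwo : ∀ u v w, ⁅S u v, w⁆ = B v w • u - B u w • v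
  faithful : ∀ x : L, (∀ u : U, ⁅x, u⁆ = 0) → x = 0

namespace IsOrthogonalRep

variable {L U : Type*} [LieRing L] [LieAlgebra ℂ L] [FiniteDimensional ℂ L]
  [AddCommGroup U] [Module ℂ U] [FiniteDimensional ℂ U]
  [LieRingModule L U] [LieModule ℂ L U]
  {B : LinearMap.BilinForm ℂ U} {S : U →ₗ[ℂ] U →ₗ[ℂ] L}

omit [FiniteDimensional ℂ L] [FiniteDimensional ℂ U] in
/-- The map `S` intertwines the action on `U` with the adjoint action. -/
theorem lie_rankTwo (hB : IsOrthogonalRep B S) (x : L) (u v : U) :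
    ⁅x, S u v⁆ = S ⁅x, u⁆ v + S u ⁅x, v⁆ := by
  rw [← sub_eq_zero]
  apply hB.faithful
  intro w
  have h1 := hB.skew x u w
  have h2 := hB.skew x v w
  rw [sub_lie, lie_lie, add_lie, hB.rankTwo, hB.rankTwo, hB.rankTwo, hB.rankTwo, lie_sub, lie_smul,
    lie_smul, h1, h2]
  simp only [neg_smul]
  abel

variable {H : LieSubalgebra ℂ L} [H.IsCartanSubalgebra]

omit [FiniteDimensional ℂ U] in
/-- The rank two elements built from opposite weight spaces have weight zero, hence lie in the
Cartan subalgebra. -/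
theorem rankTwo_mem (hB : IsOrthogonalRep B S) {χ : H → ℂ} {u v : U}
    (hu : u ∈ genWeightSpace U χ) (hv : v ∈ genWeightSpace U (-χ)) : S u v ∈ H := by
  rw [← LieAlgebra.zeroRootSubalgebra_eq_of_is_cartan ℂ L H, LieAlgebra.mem_zeroRootSubalgebra]
  intro h
  obtain ⟨k, hk⟩ := (mem_genWeightSpace U χ u).1 hu h
  obtain ⟨l, hl⟩ := (mem_genWeightSpace U (-χ) v).1 hv h
  refine ⟨k + l, pow_apply_bilin_eq_zero S _ _ _ ?_ _ k l u v rfl hk hl⟩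
  intro a b
  have := hB.lie_rankTwo (h : L) a b
  simp only [toEnd_apply_apply, LinearMap.sub_apply, LinearMap.smul_apply, Module.End.one_apply,
    map_sub, map_smul, Pi.neg_apply]
  change ⁅(h : L), S a b⁆ = S ⁅(h : L), a⁆ b - _ + (S a ⁅(h : L), b⁆ - _)
  rw [this, neg_smul]
  abel

omit [FiniteDimensional ℂ L] [FiniteDimensional ℂ U] in
/-- Weight spaces whose weights are not opposite are orthogonal. -/
theorem eq_zero_of_add_ne_zero (hB : IsOrthogonalRep B S) {χ ψ : H → ℂ} (hne : χ + ψ ≠ 0) {u v : U}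
    (hu : u ∈ genWeightSpace U χ) (hv : v ∈ genWeightSpace U ψ) : B u v = 0 := by
  obtain ⟨h, hh⟩ := Function.ne_iff.1 hne
  obtain ⟨k, hk⟩ := (mem_genWeightSpace U χ u).1 hu h
  obtain ⟨l, hl⟩ := (mem_genWeightSpace U ψ v).1 hv h
  have key := pow_apply_bilin_eq_zero B _ _ (-(χ h + ψ h) • (1 : End ℂ ℂ)) ?_ _ k l u v rfl hk hl
  · rw [smul_pow, one_pow] at key
    have hne' : -(χ h + ψ h) ≠ 0 := neg_ne_zero.2 (by simpa using hh)
    rw [LinearMap.smul_apply, Module.End.one_apply, smul_eq_mul] at key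
    exact (mul_eq_zero.1 key).resolve_left (pow_ne_zero _ hne')
  intro a b
  have := hB.skew (h : L) a b
  simp only [toEnd_apply_apply, LinearMap.sub_apply, LinearMap.smul_apply, Module.End.one_apply,
    map_sub, map_smul]
  change _ = B ⁅(h : L), a⁆ b - _ + (B a ⁅(h : L), b⁆ - _)
  rw [this]
  simp only [smul_eq_mul]
  ring

omit [FiniteDimensional ℂ L] in
/-- Opposite weight spaces are paired without degeneracy. -/
theorem exists_dual (hB : IsOrthogonalRep B S) {χ : H → ℂ} {u : U}
    (hu : u ∈ genWeightSpace U χ) (hu0 : u ≠ 0) : ∃ f ∈ genWeightSpace U (-χ), B u f = 1 := by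
  by_contra! hcon
  have h0 : ∀ f ∈ genWeightSpace U (-χ), B u f = 0 := by
    intro f hf
    by_contra hne
    exact hcon ((B u f)⁻¹ • f) (SMulMemClass.smul_mem _ hf) (by simp [hne])
  apply hu0
  apply hB.nondeg
  intro v
  have hv : v ∈ (⨆ ψ : H → ℂ, genWeightSpace U ψ : LieSubmodule ℂ H U) := by
    rw [iSup_genWeightSpace_eq_top]; trivial
  induction hv using LieSubmodule.iSup_induction' with
  | mem ψ v hv =>
    by_cases hψ : χ + ψ = 0
    · obtain rfl : ψ = -χ := (neg_eq_of_add_eq_zero_right hψ).symm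
      exact h0 v hv
    · exact hB.eq_zero_of_add_ne_zero hψ hu hv
  | zero => simp
  | add v w _ _ hv hw => rw [map_add, hv, hw, add_zero]

omit [FiniteDimensional ℂ L] in
/-- In the nilpotent Lie algebra `H`, no `ad x` has a nonzero eigenvalue. -/
theorem eq_zero_of_lie_eq_smul {x y : L} (hx : x ∈ H) (hy : y ∈ H) {c : ℂ} (hc : c ≠ 0)
    (h : ⁅x, y⁆ = c • y) : y = 0 := by
  obtain ⟨k, hk⟩ := isNilpotent_toEnd_of_isNilpotent ℂ H H (⟨x, hx⟩ : H)
  have key : ∀ n : ℕ, (toEnd ℂ H H ⟨x, hx⟩ ^ n) ⟨y, hy⟩ = c ^ n • (⟨y, hy⟩ : H) := by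
    intro n
    induction n with
    | zero => simp
    | succ n ih =>
      rw [pow_succ', Module.End.mul_apply, ih, map_smul, toEnd_apply_apply]
      have : ⁅(⟨x, hx⟩ : H), (⟨y, hy⟩ : H)⁆ = c • (⟨y, hy⟩ : H) := Subtype.ext h
      rw [this, smul_smul, pow_succ]
  have h1 := key k
  rw [hk, LinearMap.zero_apply, eq_comm, smul_eq_zero] at h1
  exact congrArg Subtype.val (h1.resolve_left (pow_ne_zero _ hc))

omit [FiniteDimensional ℂ U] in
/-- The weight spaces of nonzero weight are lines: otherwise the Cartan subalgebra would contain a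
copy of the nonabelian two-dimensional Lie algebra. -/
theorem eq_smul_of_mem (hB : IsOrthogonalRep B S) {χ : H → ℂ} (hχ : χ ≠ 0) {u f w : U}
    (hu : u ∈ genWeightSpace U χ) (hf : f ∈ genWeightSpace U (-χ)) (huf : B u f = 1)
    (hw : w ∈ genWeightSpace U χ) : w = B w f • u := by
  have hχ' : χ + χ ≠ 0 := by
    rw [← two_smul ℂ]; exact smul_ne_zero two_ne_zero hχ
  have hχ'' : -χ + -χ ≠ 0 := by
    rw [← neg_add]; exact neg_ne_zero.2 hχ'
  set y := w - B w f • u with hy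
  have hyχ : y ∈ genWeightSpace U χ := sub_mem hw (SMulMemClass.smul_mem _ hu)
  have hyf : B y f = 0 := by simp [hy, huf]
  have h1 : B u u = 0 := hB.eq_zero_of_add_ne_zero hχ' hu hu
  have h2 : B u y = 0 := hB.eq_zero_of_add_ne_zero hχ' hu hyχ
  have h3 : B f f = 0 := hB.eq_zero_of_add_ne_zero hχ'' hf hf
  -- unless `S y f = 0`, this relation contradicts the nilpotency of `H`
  have hbr : ⁅S u f, S y f⁆ = (-1 : ℂ) • S y f := by
    rw [hB.lie_rankTwo, hB.rankTwo, hB.rankTwo, hB.symm f y, hyf, h2, h3, huf]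
    simp
  have h0 : S y f = 0 := eq_zero_of_lie_eq_smul (hB.rankTwo_mem hu hf) (hB.rankTwo_mem hyχ hf)
    (by norm_num) hbr
  have h4 := hB.rankTwo y f u
  rw [h0, zero_lie, hB.symm f u, huf, hB.symm y u, h2] at h4
  rw [← sub_eq_zero]
  simpa using h4.symm

/-- On a weight space of nonzero weight the action is by scalars. -/
theorem lie_eq_smul_of_mem (hB : IsOrthogonalRep B S) {χ : H → ℂ} (hχ : χ ≠ 0) {u : U}
    (hu : u ∈ genWeightSpace U χ) (h : H) : ⁅h, u⁆ = χ h • u := by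
  by_cases hu0 : u = 0
  · simp [hu0]
  obtain ⟨f, hf, huf⟩ := hB.exists_dual hu hu0
  have h1 := hB.eq_smul_of_mem hχ hu hf huf (LieSubmodule.lie_mem _ (x := h) hu)
  set c := B ⁅h, u⁆ f
  have hs : (toEnd ℂ H U h - χ h • (1 : End ℂ U)) u = (c - χ h) • u := by
    rw [LinearMap.sub_apply, toEnd_apply_apply, h1, sub_smul]; rfl
  obtain ⟨k, hk⟩ := (mem_genWeightSpace U χ u).1 hu h
  have hp : ∀ n : ℕ, ((toEnd ℂ H U h - χ h • (1 : End ℂ U)) ^ n) u = (c - χ h) ^ n • u := by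
    intro n
    induction n with
    | zero => simp
    | succ n ih => rw [pow_succ', Module.End.mul_apply, ih, map_smul, hs, smul_smul, pow_succ]
  rw [hp, smul_eq_zero] at hk
  have hc : c = χ h := sub_eq_zero.1 (eq_zero_of_pow_eq_zero (hk.resolve_right hu0))
  rw [h1, hc]

end IsOrthogonalRep

/-- A finite set with a fixed point free involution splits into two halves that the involution
exchanges. -/
theorem exists_equiv_sum_of_involutive {W : Type*} [Finite W] {τ : W → W}
    (hτ : Function.Involutive τ) (hfix : ∀ x, τ x ≠ x) :
    ∃ (p : ℕ) (e : Fin p ⊕ Fin p ≃ W), ∀ i, e (Sum.inr i) = τ (e (Sum.inl i)) := by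
  obtain ⟨n, ⟨ord⟩⟩ := Finite.exists_equiv_fin W
  let P : Set W := {x | ord x < ord (τ x)}
  obtain ⟨p, ⟨eP⟩⟩ := Finite.exists_equiv_fin P
  have hb : Function.Bijective (Sum.elim (fun i => ((eP.symm i : P) : W))
      fun i => τ (eP.symm i : P)) := by
    constructor
    · rintro (i | i) (j | j) h
      · simp only [Sum.elim_inl] at h
        rw [eP.symm.injective (Subtype.ext h)]
      · exfalso
        have h1 := (eP.symm i).2
        have h2 := (eP.symm j).2
        simp only [Sum.elim_inl, Sum.elim_inr] at h
        simp only [P, Set.mem_ofPred_eq, h, hτ _] at h1 h2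
        exact lt_asymm h1 h2
      · exfalso
        have h1 := (eP.symm i).2
        have h2 := (eP.symm j).2
        simp only [Sum.elim_inl, Sum.elim_inr] at h
        simp only [P, Set.mem_ofPred_eq, ← h, hτ _] at h1 h2
        exact lt_asymm h1 h2
      · simp only [Sum.elim_inr] at h
        rw [eP.symm.injective (Subtype.ext (hτ.injective h))]
    · intro x
      rcases lt_trichotomy (ord x) (ord (τ x)) with h | h | h
      · exact ⟨Sum.inl (eP ⟨x, h⟩), by simp⟩
      · exact absurd (ord.injective h).symm (hfix x)
      · have h' : τ x ∈ P := by simpa [P, hτ x] using h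
        exact ⟨Sum.inr (eP ⟨τ x, h'⟩), by simp [hτ x]⟩
  exact ⟨p, Equiv.ofBijective _ hb, fun i => rfl⟩

theorem exists_mem_ne_zero_of_ne_bot {L U : Type*} [LieRing L] [AddCommGroup U] [Module ℂ U]
    [LieRingModule L U] {V : LieSubmodule ℂ L U} (h : V ≠ ⊥) : ∃ u ∈ V, u ≠ 0 := by
  by_contra! hcon
  exact h ((LieSubmodule.eq_bot_iff V).2 hcon)

namespace IsOrthogonalRep

variable {L U : Type*} [LieRing L] [LieAlgebra ℂ L] [FiniteDimensional ℂ L]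
  [AddCommGroup U] [Module ℂ U] [FiniteDimensional ℂ U]
  [LieRingModule L U] [LieModule ℂ L U]
  {B : LinearMap.BilinForm ℂ U} {S : U →ₗ[ℂ] U →ₗ[ℂ] L}
  {H : LieSubalgebra ℂ L} [H.IsCartanSubalgebra]

/-- If the zero weight space has odd dimension, it is an anisotropic line: an isotropic vector in it
would force it to be a hyperbolic plane, since `H` is nilpotent. -/
theorem exists_zero_weight_vector (hB : IsOrthogonalRep B S)
    (hodd : Odd (finrank ℂ (genWeightSpace U (0 : H → ℂ)))) :
    finrank ℂ (genWeightSpace U (0 : H → ℂ)) = 1 ∧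
      ∃ z : U, B z z = 1 ∧ z ∈ genWeightSpace U (0 : H → ℂ) ∧ ∀ h : H, ⁅h, z⁆ = 0 := by
  have hex : ∀ {u : U}, u ∈ genWeightSpace U (0 : H → ℂ) → u ≠ 0 →
      ∃ f ∈ genWeightSpace U (0 : H → ℂ), B u f = 1 := by
    intro u hu hu0
    obtain ⟨f, hf, h⟩ := hB.exists_dual hu hu0
    rw [neg_zero] at hf
    exact ⟨f, hf, h⟩
  have hmem : ∀ {u v : U}, u ∈ genWeightSpace U (0 : H → ℂ) → v ∈ genWeightSpace U (0 : H → ℂ) →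
      S u v ∈ H := by
    intro u v hu hv
    exact hB.rankTwo_mem hu (by rwa [neg_zero])
  by_cases hiso : ∃ u ∈ genWeightSpace U (0 : H → ℂ), u ≠ 0 ∧ B u u = 0
  · exfalso
    obtain ⟨u, hu, hu0, huu⟩ := hiso
    obtain ⟨f', hf', huf'⟩ := hex hu hu0
    -- correct the dual vector by a multiple of `u` to make it isotropic
    obtain ⟨f, hf, huf, hff⟩ : ∃ f ∈ genWeightSpace U (0 : H → ℂ), B u f = 1 ∧ B f f = 0 := by
      refine ⟨f' - (B f' f' / 2) • u, sub_mem hf' (SMulMemClass.smul_mem _ hu), ?_, ?_⟩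
      · simp [huf', huu]
      · simp [hB.symm f' u, huf', huu]
        ring
    -- so the zero weight space is the plane spanned by `u` and `f`, against the parity
    have hspan : ∀ w ∈ genWeightSpace U (0 : H → ℂ), w = B w f • u + B w u • f := by
      intro w hw
      set e := w - B w f • u - B w u • f with he
      have hem : e ∈ genWeightSpace U (0 : H → ℂ) :=
        sub_mem (sub_mem hw (SMulMemClass.smul_mem _ hu)) (SMulMemClass.smul_mem _ hf)
      have heu : B e u = 0 := by simp [he, huu, hB.symm f u, huf]
      have hef : B e f = 0 := by simp [he, hff, huf]
      -- unless `S u e = 0`, this relation contradicts the nilpotency of `H`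
      have hbr : ⁅S u f, S u e⁆ = (1 : ℂ) • S u e := by
        rw [hB.lie_rankTwo, hB.rankTwo, hB.rankTwo, hB.symm f u, huf, huu, hB.symm f e, hef,
          hB.symm u e, heu]
        simp
      have h0 : S u e = 0 := eq_zero_of_lie_eq_smul (hmem hu hf) (hmem hu hem) one_ne_zero hbr
      have h4 := hB.rankTwo u e f
      rw [h0, zero_lie, hef, huf] at h4
      have he0 : e = 0 := by simpa using h4.symm
      rw [he, sub_sub, sub_eq_zero] at he0
      exact he0
    have hli : LinearIndependent ℂ ![u, f] := by
      rw [LinearIndependent.pair_iff]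
      intro s t hst
      have h1 := congrArg (B u) hst
      have h2 := congrArg (B f) hst
      simp only [map_add, map_smul, huu, huf, hff, hB.symm f u, smul_eq_mul, mul_zero, mul_one,
        zero_add, add_zero, map_zero] at h1 h2
      exact ⟨h2, h1⟩
    have hsp : (genWeightSpace U (0 : H → ℂ)).toSubmodule
        = Submodule.span ℂ (Set.range ![u, f]) := by
      apply le_antisymm
      · intro w hw
        rw [hspan w hw]
        exact add_mem (Submodule.smul_mem _ _ (Submodule.subset_span ⟨0, rfl⟩))
          (Submodule.smul_mem _ _ (Submodule.subset_span ⟨1, rfl⟩))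
      · rw [Submodule.span_le]
        rintro _ ⟨i, rfl⟩
        fin_cases i
        · exact hu
        · exact hf
    have h2 : finrank ℂ (genWeightSpace U (0 : H → ℂ)) = 2 := by
      change finrank ℂ (genWeightSpace U (0 : H → ℂ)).toSubmodule = 2
      rw [hsp, finrank_span_eq_card hli, Fintype.card_fin]
    rw [h2] at hodd
    exact absurd hodd (by decide)
  · push Not at hiso
    have hpos : 0 < finrank ℂ (genWeightSpace U (0 : H → ℂ)) := hodd.pos
    obtain ⟨⟨z₀, hz₀⟩, hz₀0⟩ := finrank_pos_iff_exists_ne_zero.1 hpos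
    have hz₀n : z₀ ≠ 0 := fun h => hz₀0 (Subtype.ext h)
    have hzz : B z₀ z₀ ≠ 0 := hiso z₀ hz₀ hz₀n
    obtain ⟨c, hc⟩ := IsAlgClosed.exists_pow_nat_eq (B z₀ z₀) two_pos
    have hc0 : c ≠ 0 := by
      rintro rfl
      exact hzz (by rw [← hc]; simp)
    set z := c⁻¹ • z₀ with hz
    have hzm : z ∈ genWeightSpace U (0 : H → ℂ) := SMulMemClass.smul_mem _ hz₀
    have hz1 : B z z = 1 := by
      simp only [hz, map_smul, LinearMap.smul_apply, smul_eq_mul, ← hc]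
      field_simp
    -- A vector orthogonal to `z` and of square `-t²` would give the isotropic vector `w + t z`.
    have hspan : ∀ w ∈ genWeightSpace U (0 : H → ℂ), w = B w z • z := by
      intro w hw
      set y := w - B w z • z with hy
      have hym : y ∈ genWeightSpace U (0 : H → ℂ) := sub_mem hw (SMulMemClass.smul_mem _ hzm)
      have hyz : B y z = 0 := by simp [hy, hz1]
      obtain ⟨t, ht⟩ := IsAlgClosed.exists_pow_nat_eq (-B y y) two_pos
      have h1 : B (y + t • z) (y + t • z) = 0 := by
        simp only [map_add, map_smul, LinearMap.add_apply, LinearMap.smul_apply, hyz, hz1,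
          hB.symm z y, smul_eq_mul, mul_zero, mul_one, add_zero, zero_add, ← sq, ht]
        ring
      have h2 : y + t • z = 0 := by
        by_contra hne
        exact hiso _ (add_mem hym (SMulMemClass.smul_mem _ hzm)) hne h1
      have h3 : t = 0 := by
        have := congrArg (fun v => B v z) h2
        simpa [hyz, hz1] using this
      rw [h3, zero_smul, add_zero] at h2
      exact sub_eq_zero.1 h2
    refine ⟨?_, z, hz1, hzm, ?_⟩
    · refine finrank_eq_one (⟨z, hzm⟩ : genWeightSpace U (0 : H → ℂ)) ?_ ?_
      · intro h
        have : z = 0 := congrArg Subtype.val h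
        simp [this] at hz1
      · rintro ⟨w, hw⟩
        exact ⟨B w z, Subtype.ext (hspan w hw).symm⟩
    · intro h
      have h1 := hspan _ (LieSubmodule.lie_mem _ (x := h) hzm)
      have h2 : B ⁅h, z⁆ z = -B z ⁅h, z⁆ := hB.skew (h : L) z z
      rw [hB.symm z] at h2
      have h3 : B ⁅h, z⁆ z = 0 := by linear_combination h2 / 2
      rw [h1, h3, zero_smul]

/-- The nonzero weights of a Cartan subalgebra on `U`. -/
abbrev NonzeroWeight (H : LieSubalgebra ℂ L) [H.IsCartanSubalgebra] (U : Type*)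
    [AddCommGroup U] [Module ℂ U] [LieRingModule L U] [LieModule ℂ L U] : Type _ :=
  {χ : H → ℂ // χ ≠ 0 ∧ genWeightSpace U χ ≠ ⊥}

omit [FiniteDimensional ℂ L] in
theorem finite_nonzeroWeight : Finite (NonzeroWeight H U) :=
  Set.Finite.subset (finite_genWeightSpace_ne_bot ℂ H U) fun _ h => h.2

omit [FiniteDimensional ℂ L] in
theorem neg_genWeightSpace_ne_bot (hB : IsOrthogonalRep B S) {χ : H → ℂ}
    (h : genWeightSpace U χ ≠ ⊥) : genWeightSpace U (-χ) ≠ ⊥ := by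
  obtain ⟨u, hu, hu0⟩ := exists_mem_ne_zero_of_ne_bot h
  obtain ⟨f, hf, huf⟩ := hB.exists_dual hu hu0
  intro hbot
  rw [LieSubmodule.eq_bot_iff] at hbot
  simp [hbot f hf] at huf

theorem finrank_eq_one_of_ne_zero (hB : IsOrthogonalRep B S) (χ : NonzeroWeight H U) :
    finrank ℂ (genWeightSpace U χ.1) = 1 := by
  obtain ⟨u, hu, hu0⟩ := exists_mem_ne_zero_of_ne_bot χ.2.2
  obtain ⟨f, hf, huf⟩ := hB.exists_dual hu hu0
  refine finrank_eq_one (⟨u, hu⟩ : genWeightSpace U χ.1) (fun h => hu0 (congrArg Subtype.val h)) ?_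
  rintro ⟨w, hw⟩
  exact ⟨B w f, Subtype.ext (hB.eq_smul_of_mem χ.2.1 hu hf huf hw).symm⟩

/-- The space `U` is the direct sum of the zero weight space and of one line for each nonzero
weight. -/
theorem finrank_eq (hB : IsOrthogonalRep B S) :
    finrank ℂ U = finrank ℂ (genWeightSpace U (0 : H → ℂ)) + Nat.card (NonzeroWeight H U) := by
  classical
  have hfin : Finite (NonzeroWeight H U) := finite_nonzeroWeight
  have := Fintype.ofFinite (NonzeroWeight H U)
  let χ : Option (NonzeroWeight H U) → H → ℂ := fun o => o.elim 0 Subtype.val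
  have hχ : Function.Injective χ := by
    rintro (_ | a) (_ | b) h
    · rfl
    · exact absurd h.symm b.2.1
    · exact absurd h a.2.1
    · exact congrArg some (Subtype.ext h)
  let V : Option (NonzeroWeight H U) → Submodule ℂ U :=
    fun o => (genWeightSpace U (χ o)).toSubmodule
  have hind : iSupIndep V := by
    have h := (iSupIndep_genWeightSpace ℂ H U).comp hχ
    rw [← LieSubmodule.iSupIndep_toSubmodule] at h
    exact h
  have htop : iSup V = ⊤ := by
    have h : (⨆ ψ : H → ℂ, genWeightSpace U ψ) = ⊤ := iSup_genWeightSpace_eq_top ℂ H U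
    rw [← LieSubmodule.toSubmodule_inj, LieSubmodule.iSup_toSubmodule,
      LieSubmodule.top_toSubmodule] at h
    rw [← top_le_iff, ← h]
    refine iSup_le fun ψ => ?_
    by_cases h0 : ψ = 0
    · subst h0
      exact le_iSup V none
    by_cases hb : genWeightSpace U ψ = ⊥
    · rw [hb]; simp
    · exact le_iSup V (some ⟨ψ, h0, hb⟩)
  have hint := DirectSum.isInternal_submodule_of_iSupIndep_of_iSup_eq_top hind htop
  have e := LinearEquiv.ofBijective (DirectSum.coeLinearMap V) hint
  rw [← e.finrank_eq, Module.finrank_directSum, Fintype.sum_option, Nat.card_eq_fintype_card]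
  congr 1
  exact (Finset.sum_congr rfl fun χ _ => hB.finrank_eq_one_of_ne_zero χ).trans (by simp)

/-- A Cartan subalgebra of the orthogonal Lie algebra in odd dimension `2ℓ + 1` is diagonal with
respect to a hyperbolic basis `u_i, v_i, z`. The vectors `d_j`, on which the weights `w_i` of the
`u_i` take the values `δ_ij`, show that these weights are linearly independent. -/
theorem exists_hyperbolic_basis (hB : IsOrthogonalRep B S) {ℓ : ℕ} (hdim : finrank ℂ U = 2 * ℓ + 1)
    (H : LieSubalgebra ℂ L) [H.IsCartanSubalgebra] :
    ∃ (w : Fin ℓ → H → ℂ) (d : Fin ℓ → H) (u v : Fin ℓ → U) (z : U),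
      (∀ (h : H) i, ⁅(h : L), u i⁆ = w i h • u i) ∧ (∀ (h : H) i, ⁅(h : L), v i⁆ = -w i h • v i) ∧
      (∀ h : H, ⁅(h : L), z⁆ = 0) ∧ (∀ i j, w i (d j) = if i = j then 1 else 0) ∧
      (∀ i j, B (u i) (v j) = if i = j then 1 else 0) ∧ (∀ i j, B (u i) (u j) = 0) ∧
      (∀ i j, B (v i) (v j) = 0) ∧ (∀ i, B (u i) z = 0) ∧ (∀ i, B (v i) z = 0) ∧ B z z = 1 := by
  have hfin : Finite (NonzeroWeight H U) := finite_nonzeroWeight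
  let τ : NonzeroWeight H U → NonzeroWeight H U := fun χ =>
    ⟨-χ.1, neg_ne_zero.2 χ.2.1, hB.neg_genWeightSpace_ne_bot χ.2.2⟩
  have hττ : Function.Involutive τ := fun χ => Subtype.ext (neg_neg _)
  obtain ⟨p, e, he⟩ := exists_equiv_sum_of_involutive hττ
    fun χ h => χ.2.1 (self_eq_neg.1 (congrArg Subtype.val h).symm)
  have hcount := hB.finrank_eq (H := H)
  have hcard : Nat.card (NonzeroWeight H U) = p + p := by
    rw [← Nat.card_congr e, Nat.card_eq_fintype_card]; simp
  rw [hcard, hdim] at hcount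
  -- nonzero weights come in pairs `±χ`, hence the zero weight space has odd dimension
  obtain ⟨h1, z, hzz, hz, hz0⟩ := hB.exists_zero_weight_vector (H := H)
    (by rw [← Nat.not_even_iff_odd, Nat.even_iff]; omega)
  obtain rfl : p = ℓ := by omega
  set χ : Fin p → H → ℂ := fun i => (e (Sum.inl i)).1 with hχ
  have hχneg : ∀ i, (e (Sum.inr i)).1 = -χ i := fun i => by rw [he]
  have hχ0 : ∀ i, χ i ≠ 0 := fun i => (e (Sum.inl i)).2.1
  have hne : ∀ i j, i ≠ j → χ i + -χ j ≠ 0 := by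
    intro i j hij h
    rw [← sub_eq_add_neg, sub_eq_zero] at h
    exact hij (Sum.inl_injective (e.injective (Subtype.ext h)))
  have hadd : ∀ i j, χ i + χ j ≠ 0 := by
    intro i j h
    have : (e (Sum.inl i)).1 = (e (Sum.inr j)).1 := by
      rw [hχneg]
      exact eq_neg_of_add_eq_zero_left h
    exact Sum.inl_ne_inr (e.injective (Subtype.ext this))
  choose u hu hu0 using fun i => exists_mem_ne_zero_of_ne_bot (e (Sum.inl i)).2.2
  choose v hv huv using fun i => hB.exists_dual (hu i) (hu0 i)
  have huv' : ∀ i j, B (u i) (v j) = if i = j then 1 else 0 := by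
    intro i j
    split_ifs with hij
    · subst hij; exact huv i
    · exact hB.eq_zero_of_add_ne_zero (hne i j hij) (hu i) (hv j)
  have huu : ∀ i j, B (u i) (u j) = 0 :=
    fun i j => hB.eq_zero_of_add_ne_zero (hadd i j) (hu i) (hu j)
  have hact : ∀ (h : H) i, ⁅(h : L), u i⁆ = χ i h • u i :=
    fun h i => hB.lie_eq_smul_of_mem (hχ0 i) (hu i) h
  refine ⟨χ, fun i => ⟨S (u i) (v i), hB.rankTwo_mem (hu i) (hv i)⟩, u, v, z, hact,
    fun h i => hB.lie_eq_smul_of_mem (neg_ne_zero.2 (hχ0 i)) (hv i) h, hz0, ?_, huv', huu, ?_, ?_,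
    ?_, hzz⟩
  · intro i j
    have h := hact ⟨S (u j) (v j), hB.rankTwo_mem (hu j) (hv j)⟩ i
    simp only [hB.rankTwo, huu, zero_smul, sub_zero, hB.symm (v j) (u i), huv'] at h
    split_ifs at h ⊢ with hij
    · subst hij
      exact smul_left_injective ℂ (hu0 i) h.symm
    · rw [zero_smul, eq_comm, smul_eq_zero] at h
      exact h.resolve_right (hu0 i)
  · intro i j
    refine hB.eq_zero_of_add_ne_zero ?_ (hv i) (hv j)
    rw [← neg_add]
    exact neg_ne_zero.2 (hadd i j)
  · exact fun i => hB.eq_zero_of_add_ne_zero (by rw [add_zero]; exact hχ0 i) (hu i) hz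
  · exact fun i =>
      hB.eq_zero_of_add_ne_zero (by rw [add_zero]; exact neg_ne_zero.2 (hχ0 i)) (hv i) hz

end IsOrthogonalRep

end

/-! ### A hyperbolic basis that diagonalizes the Cartan subalgebra -/

section

open Module Matrix

attribute [local instance 100] LieRing.ofAssociativeRing

/-- Labels of a hyperbolic basis: `inl (inl i)` and `inl (inr i)` label the vectors of weight `ε_i`
and `-ε_i`, and `inr j` labels vectors of weight zero. -/
abbrev Col (ℓ m : ℕ) : Type := (Fin ℓ ⊕ Fin ℓ) ⊕ Fin (2 ^ (m + 1))

/-- The label of the dual basis vector. -/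
def opp {ℓ m : ℕ} : Col ℓ m → Col ℓ m := Sum.map Sum.swap id

theorem opp_opp {ℓ m : ℕ} (b : Col ℓ m) : opp (opp b) = b := by
  rcases b with (i | i) | j <;> rfl

/-- The coordinates of the weight of a basis vector with respect to `ε_1, …, ε_ℓ`. -/
def wt {ℓ m : ℕ} : Col ℓ m → Fin ℓ → ℤ :=
  Sum.elim (Sum.elim (fun i => Pi.single i 1) fun i => -Pi.single i 1) 0

/-- The value of the weight of a basis vector, where `c` lists the values of `ε_1, …, ε_ℓ`. -/
def wtEval {ℓ m : ℕ} (c : Fin ℓ → ℂ) (b : Col ℓ m) : ℂ := ∑ i, (wt b i : ℂ) * c i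

theorem wt_opp {ℓ m : ℕ} (b : Col ℓ m) : wt (opp b) = -wt b := by
  rcases b with (i | i) | j <;> simp [wt, opp]

/-- The eigenvalue of `J_k` on a basis vector. -/
def sgn {ℓ m : ℕ} (k : ℕ) : Col ℓ m → ℂ := Sum.elim (fun _ => 1) fun j => (-1) ^ (j.val / 2 ^ k)

theorem sgn_opp {ℓ m : ℕ} (k : ℕ) (b : Col ℓ m) : sgn k (opp b) = sgn k b := by
  rcases b with (i | i) | j <;> rfl

/-- The Gram matrix of a hyperbolic basis. -/
def gram (ℓ m : ℕ) : Matrix (Col ℓ m) (Col ℓ m) ℂ := (1 : Matrix _ _ ℂ).submatrix id opp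

theorem gram_apply {ℓ m : ℕ} (b c : Col ℓ m) : gram ℓ m b c = if b = opp c then 1 else 0 := by
  simp [gram, Matrix.one_apply]

theorem neg_one_pow_eq_iff (a b : ℕ) : (-1 : ℂ) ^ a = (-1) ^ b ↔ a % 2 = b % 2 := by
  rw [neg_one_pow_eq_pow_mod_two, neg_one_pow_eq_pow_mod_two (n := b)]
  rcases Nat.mod_two_eq_zero_or_one a with h | h <;>
    rcases Nat.mod_two_eq_zero_or_one b with h' | h' <;> simp [h, h'] <;> norm_num

/-- The signs `(-1)^⌊j/2^k⌋` are given by the binary digits of `j`, hence they determine `j`. -/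
theorem eq_of_signs_eq {m j j' : ℕ} (hj : j < 2 ^ (m + 1)) (hj' : j' < 2 ^ (m + 1))
    (h : ∀ k ≤ m, (-1 : ℂ) ^ (j / 2 ^ k) = (-1) ^ (j' / 2 ^ k)) : j = j' := by
  apply Nat.eq_of_testBit_eq
  intro k
  by_cases hk : k ≤ m
  · rw [Nat.testBit_eq_decide_div_mod_eq, Nat.testBit_eq_decide_div_mod_eq,
      (neg_one_pow_eq_iff _ _).1 (h k hk)]
  · have : 2 ^ (m + 1) ≤ 2 ^ k := Nat.pow_le_pow_right two_pos (by omega)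
    rw [Nat.testBit_eq_false_of_lt (hj.trans_le this),
      Nat.testBit_eq_false_of_lt (hj'.trans_le this)]

/-- Every pattern of signs is realized by some `j`. -/
theorem exists_signs_eq (m : ℕ) (s : ℕ → ℤ) :
    ∃ j : Fin (2 ^ (m + 1)), ∀ k ≤ m, (-1 : ℂ) ^ (j.val / 2 ^ k) = (-1) ^ s k := by
  let f : Fin (m + 1) → Bool := fun k => decide (Odd (s k))
  refine ⟨⟨Nat.ofBits f, Nat.ofBits_lt_two_pow f⟩, fun k hk => ?_⟩
  have h := Nat.testBit_ofBits_lt f k (by omega)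
  rw [Nat.testBit_eq_decide_div_mod_eq] at h
  simp only [f] at h
  rcases Int.even_or_odd (s k) with he | he
  · have h' : Nat.ofBits f / 2 ^ k % 2 = 0 := by simpa [f, Int.not_odd_iff_even.2 he] using h
    rw [he.neg_one_zpow, neg_one_pow_eq_pow_mod_two]
    simp only [h', pow_zero]
  · have h' : Nat.ofBits f / 2 ^ k % 2 = 1 := by simpa [f, he] using h
    rw [he.neg_one_zpow, neg_one_pow_eq_pow_mod_two]
    simp only [h', pow_one]

theorem J_mul_eq_mul_J_iff {ℓ m k : ℕ} (X : Matrix (Idx ℓ m) (Idx ℓ m) ℂ) :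
    J ℓ m k * X = X * J ℓ m k ↔ ∀ a b, signJ ℓ m k a * X a b = X a b * signJ ℓ m k b := by
  simp [← Matrix.ext_iff, J, Matrix.diagonal_mul, Matrix.mul_diagonal]

/-- An antisymmetric matrix that commutes with all `J_k` vanishes outside of the block of size
`2ℓ + 1`. -/
theorem apply_inr_eq_zero {ℓ m : ℕ} {X : Matrix (Idx ℓ m) (Idx ℓ m) ℂ} (hX : Xᵀ = -X)
    (hJ : ∀ k ≤ m, J ℓ m k * X = X * J ℓ m k) {j : Fin (2 ^ (m + 1))} (hj : j ≠ 0) (a : Idx ℓ m) :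
    X (Sum.inr j) a = 0 := by
  by_contra hne
  have hs : ∀ k ≤ m, signJ ℓ m k (Sum.inr j) = signJ ℓ m k a := by
    intro k hk
    have h := (J_mul_eq_mul_J_iff X).1 (hJ k hk) (Sum.inr j) a
    rw [mul_comm] at h
    exact mul_left_cancel₀ hne h
  rcases a with a | a
  · apply hj
    apply Fin.ext
    refine eq_of_signs_eq (m := m) j.2 (Nat.two_pow_pos _) fun k hk => ?_
    simpa [signJ] using hs k hk
  · obtain rfl : j = a := Fin.ext (eq_of_signs_eq (m := m) j.2 a.2 hs)
    have h : X (Sum.inr j) (Sum.inr j) = -X (Sum.inr j) (Sum.inr j) :=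
      congrFun (congrFun hX (Sum.inr j)) (Sum.inr j)
    exact hne (self_eq_neg.1 h)

/-- The space of vectors that are supported on the block of size `2ℓ + 1`, i.e. that are fixed by
all `J_k`. -/
def corner (ℓ m : ℕ) : Submodule ℂ (Idx ℓ m → ℂ) where
  carrier := {v | ∀ j : Fin (2 ^ (m + 1)), j ≠ 0 → v (Sum.inr j) = 0}
  add_mem' hu hv j hj := by simp [hu j hj, hv j hj]
  zero_mem' j _ := rfl
  smul_mem' c v hv j hj := by simp [hv j hj]

theorem finrank_corner (ℓ m : ℕ) : finrank ℂ (corner ℓ m) = 2 * ℓ + 1 := by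
  let e : corner ℓ m ≃ₗ[ℂ] (Fin (2 * ℓ) ⊕ Unit → ℂ) :=
    { toFun := fun u => Sum.elim (fun i => u.1 (Sum.inl i)) fun _ => u.1 (Sum.inr 0)
      map_add' := fun u v => by ext (i | i) <;> rfl
      map_smul' := fun c v => by ext (i | i) <;> rfl
      invFun := fun g => ⟨Sum.elim (fun i => g (Sum.inl i))
        fun j => if j = 0 then g (Sum.inr ()) else 0, fun j hj => by simp [hj]⟩
      left_inv := fun u => by
        apply Subtype.ext
        ext (i | j)
        · rfl
        · by_cases hj : j = 0
          · simp [hj]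
          · simp [hj, u.2 j hj]
      right_inv := fun g => by ext (i | i) <;> simp }
  rw [e.finrank_eq, Module.finrank_fintype_fun_eq_card]
  simp

theorem J_mulVec_of_mem_corner {ℓ m : ℕ} (k : ℕ) {u : Idx ℓ m → ℂ} (hu : u ∈ corner ℓ m) :
    J ℓ m k *ᵥ u = u := by
  ext (i | j)
  · simp [J, Matrix.mulVec_diagonal, signJ]
  · by_cases hj : j = 0
    · simp [J, Matrix.mulVec_diagonal, signJ, hj]
    · simp [J, Matrix.mulVec_diagonal, hu j hj]

/-- The columns of `P` form a hyperbolic basis of `ℂ^(2ℓ + 2^(m+1))` that diagonalizes the matrices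
`J_k`, and in which the Lie algebra `H`, acting through `μ`, becomes the Lie algebra of all diagonal
matrices in the block of size `2ℓ`. -/
structure IsHyperbolicBasis {ℓ m : ℕ} {H : Type*} [AddCommGroup H] [Module ℂ H]
    (μ : H → Matrix (Idx ℓ m) (Idx ℓ m) ℂ) (d : Basis (Fin ℓ) ℂ H)
    (P : Matrix (Idx ℓ m) (Col ℓ m) ℂ) : Prop where
  gram_eq : Pᵀ * P = gram ℓ m
  mul_eq : ∀ h, μ h * P = P * (diagonal (wtEval (d.repr h)) : Matrix (Col ℓ m) (Col ℓ m) ℂ)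
  J_mul_eq : ∀ k, J ℓ m k * P = P * (diagonal (sgn k) : Matrix (Col ℓ m) (Col ℓ m) ℂ)

section

variable {ℓ m : ℕ} {L : Type*} [LieRing L] [LieAlgebra ℂ L]
  {μ : L →ₗ⁅ℂ⁆ Matrix (Idx ℓ m) (Idx ℓ m) ℂ}

/-- The action, through `μ`, of a Lie algebra of antisymmetric matrices that commute with all `J_k`
on the space `corner ℓ m`. -/
abbrev cornerLieRingModule (hμ : ∀ x, (μ x)ᵀ = -μ x ∧ ∀ k ≤ m, J ℓ m k * μ x = μ x * J ℓ m k) :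
    LieRingModule L (corner ℓ m) where
  bracket x u := ⟨μ x *ᵥ u.1, fun j hj => by
    simp [Matrix.mulVec, dotProduct, apply_inr_eq_zero (hμ x).1 (hμ x).2 hj]⟩
  add_lie x y u := Subtype.ext (by
    change μ (x + y) *ᵥ u.1 = μ x *ᵥ u.1 + μ y *ᵥ u.1
    rw [map_add, Matrix.add_mulVec])
  lie_add x u v := Subtype.ext (by
    change μ x *ᵥ (u.1 + v.1) = μ x *ᵥ u.1 + μ x *ᵥ v.1
    rw [Matrix.mulVec_add])
  leibniz_lie x y u := Subtype.ext (by
    change μ x *ᵥ (μ y *ᵥ u.1) = μ ⁅x, y⁆ *ᵥ u.1 + μ y *ᵥ (μ x *ᵥ u.1)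
    rw [LieHom.map_lie, Ring.lie_def, Matrix.sub_mulVec, Matrix.mulVec_mulVec,
      Matrix.mulVec_mulVec, sub_add_cancel])

/-- For a Cartan subalgebra `H` of the Lie algebra of antisymmetric matrices that commute with all
`J_k`, a hyperbolic basis of the block of size `2ℓ + 1` in which `H` is diagonal is completed to a
hyperbolic basis of the whole space by those standard basis vectors that lie outside of the
block. -/
theorem exists_isHyperbolicBasis [FiniteDimensional ℂ L] (hinj : Function.Injective μ)
    (hrange : ∀ X, (∃ x, μ x = X) ↔ Xᵀ = -X ∧ ∀ k ≤ m, J ℓ m k * X = X * J ℓ m k)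
    (H : LieSubalgebra ℂ L) [H.IsCartanSubalgebra] :
    ∃ (d : Basis (Fin ℓ) ℂ H) (P : Matrix (Idx ℓ m) (Col ℓ m) ℂ),
      IsHyperbolicBasis (fun h : H => μ h) d P := by
  have hμ : ∀ x, (μ x)ᵀ = -μ x ∧ ∀ k ≤ m, J ℓ m k * μ x = μ x * J ℓ m k :=
    fun x => (hrange (μ x)).1 ⟨x, rfl⟩
  let _ : LieRingModule L (corner ℓ m) := cornerLieRingModule hμ
  have hlie : ∀ (x : L) (u : corner ℓ m), (⁅x, u⁆ : corner ℓ m).1 = μ x *ᵥ u.1 := fun _ _ => rfl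
  have : LieModule ℂ L (corner ℓ m) :=
    { smul_lie := fun c x u => Subtype.ext (by
        rw [hlie, map_smul, Matrix.smul_mulVec]; rfl)
      lie_smul := fun c x u => Subtype.ext (by
        change μ x *ᵥ (c • u.1) = c • (μ x *ᵥ u.1)
        rw [Matrix.mulVec_smul]) }
  let B : LinearMap.BilinForm ℂ (corner ℓ m) := LinearMap.mk₂ ℂ (fun u v => u.1 ⬝ᵥ v.1)
    (fun u v w => add_dotProduct _ _ _) (fun c u v => smul_dotProduct _ _ _)
    (fun u v w => dotProduct_add _ _ _) (fun c u v => dotProduct_smul _ _ _)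
  have hBdef : ∀ u v, B u v = u.1 ⬝ᵥ v.1 := fun _ _ => rfl
  -- the matrices of the operators `w ↦ B(v, w) u - B(u, w) v`
  let T : corner ℓ m → corner ℓ m → Matrix (Idx ℓ m) (Idx ℓ m) ℂ := fun u v =>
    vecMulVec u.1 v.1 - vecMulVec v.1 u.1
  have hT : ∀ u v, ∃ x, μ x = T u v := by
    intro u v
    rw [hrange]
    refine ⟨?_, fun k _ => ?_⟩
    · simp only [T, transpose_sub, transpose_vecMulVec, neg_sub]
    · have hJ : ∀ a b : corner ℓ m,
          J ℓ m k * vecMulVec a.1 b.1 = vecMulVec a.1 b.1 * J ℓ m k := by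
        intro a b
        rw [mul_vecMulVec, vecMulVec_mul, J_mulVec_of_mem_corner k a.2, ← J_transpose,
          vecMul_transpose, J_mulVec_of_mem_corner k b.2]
      simp only [T, mul_sub, sub_mul, hJ]
  choose S' hS' using hT
  let S : corner ℓ m →ₗ[ℂ] corner ℓ m →ₗ[ℂ] L := LinearMap.mk₂ ℂ S'
    (fun u v w => hinj (by
      rw [map_add, hS', hS', hS']
      simp only [T, Submodule.coe_add, add_vecMulVec, vecMulVec_add]; abel))
    (fun c u v => hinj (by
      rw [map_smul, hS', hS']
      simp only [T, Submodule.coe_smul, smul_vecMulVec, vecMulVec_smul, smul_sub]))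
    (fun u v w => hinj (by
      rw [map_add, hS', hS', hS']
      simp only [T, Submodule.coe_add, add_vecMulVec, vecMulVec_add]; abel))
    (fun c u v => hinj (by
      rw [map_smul, hS', hS']
      simp only [T, Submodule.coe_smul, smul_vecMulVec, vecMulVec_smul, smul_sub]))
  have hSdef : ∀ u v, μ (S u v) = T u v := hS'
  have hrep : IsOrthogonalRep B S :=
    { symm := fun u v => by rw [hBdef, hBdef, dotProduct_comm]
      nondeg := by
        intro u hu
        have h : ∀ a, (Pi.single a 1 : Idx ℓ m → ℂ) ∈ corner ℓ m → u.1 a = 0 := by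
          intro a ha
          have := hu ⟨_, ha⟩
          rwa [hBdef, dotProduct_single, mul_one] at this
        apply Subtype.ext
        ext (i | j)
        · exact h _ fun j hj => by simp
        · by_cases hj : j = 0
          · exact h _ fun j' hj' => by simp [hj, hj']
          · exact u.2 j hj
      skew := by
        intro x u v
        rw [hBdef, hBdef, hlie, hlie, dotProduct_mulVec, ← mulVec_transpose, (hμ x).1, neg_mulVec,
          neg_dotProduct, neg_neg]
      rankTwo := by
        intro u v w
        apply Subtype.ext
        rw [hlie, hSdef, Matrix.sub_mulVec, vecMulVec_mulVec, vecMulVec_mulVec]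
        simp [hBdef]
      faithful := by
        intro x hx
        apply hinj
        rw [map_zero]
        have h : ∀ a, (Pi.single a 1 : Idx ℓ m → ℂ) ∈ corner ℓ m → ∀ b, μ x b a = 0 := by
          intro a ha b
          have := congrArg Subtype.val (hx ⟨_, ha⟩)
          rw [hlie, mulVec_single_one] at this
          exact congrFun this b
        ext b (i | j)
        · exact h _ (fun j hj => by simp) b
        · by_cases hj : j = 0
          · exact h _ (fun j' hj' => by simp [hj, hj']) b
          · have h1 := congrFun (congrFun (hμ x).1 b) (Sum.inr j)
            rw [transpose_apply, apply_inr_eq_zero (hμ x).1 (hμ x).2 hj] at h1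
            simpa using h1.symm }
  obtain ⟨w, d, u, v, z, hu, hv, hz, hwd, huv, huu, hvv, huz, hvz, hzz⟩ :=
    hrep.exists_hyperbolic_basis (finrank_corner ℓ m) H
  let col : Col ℓ m → Idx ℓ m → ℂ := Sum.elim (Sum.elim (fun i => (u i).1) fun i => (v i).1)
    fun j => if j = 0 then z.1 else Pi.single (Sum.inr j) 1
  let P : Matrix (Idx ℓ m) (Col ℓ m) ℂ := Matrix.of fun a b => col b a
  simp only [hBdef] at huv huu hvv hzz
  have hsing : ∀ (a : corner ℓ m) (j : Fin (2 ^ (m + 1))), j ≠ 0 →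
      a.1 ⬝ᵥ Pi.single (Sum.inr j) 1 = 0 := by
    intro a j hj
    rw [dotProduct_single, mul_one, a.2 j hj]
  have hz_col : ∀ a : corner ℓ m, B a z = 0 → ∀ j, a.1 ⬝ᵥ col (Sum.inr j) = 0 := by
    intro a ha j
    by_cases hj : j = 0
    · rw [hBdef] at ha
      simpa [col, hj] using ha
    · simpa [col, hj] using hsing a j hj
  have hcol : ∀ b c, col b ⬝ᵥ col c = if b = opp c then 1 else 0 := by
    rintro ((i | i) | i) ((j | j) | j)
    · simpa [col, opp] using huu i j
    · simpa [col, opp] using huv i j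
    · exact (hz_col _ (huz i) j).trans (by simp [opp])
    · rw [dotProduct_comm]
      simpa [col, opp, eq_comm] using huv j i
    · simpa [col, opp] using hvv i j
    · exact (hz_col _ (hvz i) j).trans (by simp [opp])
    · rw [dotProduct_comm]
      exact (hz_col _ (huz j) i).trans (by simp [opp])
    · rw [dotProduct_comm]
      exact (hz_col _ (hvz j) i).trans (by simp [opp])
    · by_cases hi : i = 0
      · by_cases hj : j = 0
        · simpa [col, opp, hi, hj] using hzz
        · simpa [col, opp, hi, hj, Ne.symm hj] using hsing z j hj
      · by_cases hj : j = 0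
        · rw [dotProduct_comm]
          simpa [col, opp, hi, hj] using hsing z i hi
        · simp [col, opp, hi, hj, Pi.single_apply, eq_comm]
  have hgram : Pᵀ * P = gram ℓ m := by
    ext b c
    rw [gram_apply]
    exact hcol b c
  have hPmul : ∀ (X : Matrix (Idx ℓ m) (Idx ℓ m) ℂ) (D : Col ℓ m → ℂ),
      (∀ b, X *ᵥ col b = D b • col b) →
        X * P = P * (diagonal D : Matrix (Col ℓ m) (Col ℓ m) ℂ) := by
    intro X D h
    ext a b
    rw [mul_diagonal]
    exact (congrFun (h b) a).trans (mul_comm _ _)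
  have hact : ∀ h : H,
      μ h * P = P * (diagonal (wtEval fun i => w i h) : Matrix (Col ℓ m) (Col ℓ m) ℂ) := by
    intro h
    apply hPmul
    rintro ((i | i) | j)
    · have := congrArg Subtype.val (hu h i)
      rw [hlie] at this
      simpa [wtEval, wt, col, Pi.single_apply] using this
    · have := congrArg Subtype.val (hv h i)
      rw [hlie] at this
      simpa [wtEval, wt, col, Pi.single_apply] using this
    · by_cases hj : j = 0
      · have := congrArg Subtype.val (hz h)
        rw [hlie] at this
        simpa [wtEval, wt, col, hj] using this
      · have hcol0 : μ (h : L) *ᵥ Pi.single (Sum.inr j) 1 = 0 := by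
          rw [mulVec_single_one]
          ext a
          have h1 := congrFun (congrFun (hμ h).1 a) (Sum.inr j)
          rw [transpose_apply, apply_inr_eq_zero (hμ h).1 (hμ h).2 hj] at h1
          simpa using h1.symm
        simpa [wtEval, wt, col, hj] using hcol0
  have hJact : ∀ k, J ℓ m k * P = P * (diagonal (sgn k) : Matrix (Col ℓ m) (Col ℓ m) ℂ) := by
    intro k
    apply hPmul
    rintro ((i | i) | j)
    · simpa [col, sgn] using J_mulVec_of_mem_corner k (u i).2
    · simpa [col, sgn] using J_mulVec_of_mem_corner k (v i).2
    · by_cases hj : j = 0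
      · simpa [col, hj, sgn] using J_mulVec_of_mem_corner k z.2
      · simp only [col, hj, sgn, Sum.elim_inr, if_false, J, Matrix.diagonal_mulVec_single]
        ext a
        simp [Pi.single_apply, signJ]
  have hPinv : gram ℓ m * Pᵀ * P = 1 := by
    rw [Matrix.mul_assoc, hgram]
    ext b c
    simp [gram, Matrix.mul_apply, Matrix.one_apply, opp_opp]
  have hPinv' : P * (gram ℓ m * Pᵀ) = 1 :=
    (Matrix.mul_eq_one_comm_of_card_eq _ _ _ (by simp; ring)).1 hPinv
  -- the weights are entries of the transformed matrices, so they are linear in `h`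
  have hw : ∀ (h : H) i, w i h = (gram ℓ m * Pᵀ * (μ h * P)) (Sum.inl (Sum.inl i))
      (Sum.inl (Sum.inl i)) := by
    intro h i
    rw [hact, ← Matrix.mul_assoc, hPinv, Matrix.one_mul, diagonal_apply_eq]
    simp [wtEval, wt, Pi.single_apply]
  let W : H →ₗ[ℂ] Fin ℓ → ℂ :=
    { toFun := fun h i => w i h
      map_add' := fun a b => by
        ext i
        simp [hw, Matrix.add_mul, Matrix.mul_add]
      map_smul' := fun c a => by
        ext i
        simp [hw] }
  have hWker : ∀ h, W h = 0 → h = 0 := by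
    intro h hh
    have h1 : μ h * P = 0 := by
      rw [hact]
      have h0 : wtEval (fun i => w i h) = (0 : Col ℓ m → ℂ) := by
        ext b
        simp [wtEval, show ∀ i, w i h = 0 from fun i => congrFun hh i]
      rw [h0, diagonal_zero', Matrix.mul_zero]
    have h2 : μ (h : L) = 0 := by
      rw [← Matrix.mul_one (μ (h : L)), ← hPinv', ← Matrix.mul_assoc, h1, Matrix.zero_mul]
    exact Subtype.ext (hinj (h2.trans (map_zero μ).symm))
  have hWsurj : Function.Surjective W := by
    intro c
    refine ⟨∑ j, c j • d j, ?_⟩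
    rw [map_sum]
    ext i
    simp [W, hwd]
  have hWinj : Function.Injective W := (injective_iff_map_eq_zero W).2 hWker
  refine ⟨Basis.ofEquivFun (LinearEquiv.ofBijective W ⟨hWinj, hWsurj⟩), P, hgram, ?_, hJact⟩
  intro h
  rw [hact]
  rfl

end

end

/-! ### Roots of twisted toroidal algebras -/

section

open Module

attribute [local instance 100] LieRing.ofAssociativeRing

section

variable {N : ℕ} {𝔤 : Type} [LieRing 𝔤] [LieAlgebra ℂ 𝔤]

theorem lieLoop_tens_zero_apply (x : 𝔤) (f : Loop N 𝔤) (m : Deg N) :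
    lieLoop N 𝔤 (tens 0 x) f m = ⁅x, f m⁆ := by
  induction f using loop_induction with
  | h0 => simp
  | hadd f g hf hg => rw [map_add, Finsupp.add_apply, hf, hg, Finsupp.add_apply, lie_add]
  | h1 r y =>
    rw [lieLoop_tens, zero_add]
    by_cases h : r = m
    · subst h; simp [tens]
    · simp [tens, h]

theorem cocycle_tens_zero (x : 𝔤) (f : Loop N 𝔤) : cocycle N 𝔤 (tens 0 x) f = 0 := by
  induction f using loop_induction with
  | h0 => simp
  | hadd f g hf hg => rw [map_add, hf, hg, add_zero]
  | h1 r y =>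
    rw [cocycle_tens]
    have : (fun p => (((0 : Deg N) p : ℤ) : ℂ)) = 0 := by ext; simp
    rw [this, map_zero, smul_zero]

theorem degLoop_apply (a : Fin (N + 1) → ℂ) (f : Loop N 𝔤) (m : Deg N) :
    degLoop a f m = (∑ p, a p * m p) • f m := by
  induction f using loop_induction with
  | h0 => simp
  | hadd f g hf hg => rw [map_add, Finsupp.add_apply, hf, hg, Finsupp.add_apply, smul_add]
  | h1 r y =>
    rw [degLoop_tens, Finsupp.smul_apply]
    by_cases h : r = m
    · subst h; rfl
    · simp [tens, h]

namespace Family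

variable (S : Family N 𝔤)

theorem apply_mem_eigen {f : Loop N 𝔤} (hf : f ∈ S.loopPart) (m : Deg N) : f m ∈ S.eigen m := by
  induction hf using Submodule.span_induction with
  | zero => exact zero_mem _
  | add f g _ _ hf hg => exact add_mem hf hg
  | smul c f _ hf => exact Submodule.smul_mem _ _ hf
  | mem f hf =>
    obtain ⟨r, x, hx, rfl⟩ := hf
    by_cases h : r = m
    · subst h; simpa [tens] using hx
    · simp [tens, h]

variable (H : LieSubalgebra ℂ S.fixed)

theorem loop_incl_lie (h : S.Cartan H) (x : S.twisted) :
    Algebra.loop (⁅S.incl H h, x⁆ : S.twisted).1 =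
      lieLoop N 𝔤 (tens 0 ((h.1 : S.fixed) : 𝔤)) (Algebra.loop x.1) +
        degLoop h.2.1 (Algebra.loop x.1) := by
  rw [LieSubalgebra.coe_bracket, Algebra.loop_lie]
  simp [incl, degLoop_tens]

theorem cen_incl_lie (h : S.Cartan H) (x : S.twisted) :
    Algebra.cen (⁅S.incl H h, x⁆ : S.twisted).1 = degForms h.2.1 (Algebra.cen x.1) := by
  rw [LieSubalgebra.coe_bracket, Algebra.cen_lie]
  simp [incl, degForms_form, cocycle_tens_zero]

/-- A linear form with nonzero component on `H` is a weight of the twisted algebra exactly if its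
component along the `δ_j` is integral, equal to `k`, and its component on `H` is a weight of the
joint eigenspace of degree `k`. -/
theorem rootSpace_ne_bot_iff {l : Dual ℂ H} (hl : l ≠ 0) (c : Fin (N + 1) → ℂ) :
    S.rootSpace H (S.extend H l + ∑ j, c j • S.delta H j) ≠ ⊥ ↔
      ∃ k : Deg N, c = (fun j => (k j : ℂ)) ∧
        ∃ x ∈ S.eigen k, x ≠ 0 ∧ ∀ h : H, ⁅((h : S.fixed) : 𝔤), x⁆ = l h • x := by
  have hα : ∀ h : S.Cartan H, (S.extend H l + ∑ j, c j • S.delta H j) h =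
      l h.1 + ∑ j, c j * h.2.1 j := by
    intro h
    simp [extend, delta]
  rw [Submodule.ne_bot_iff]
  constructor
  · rintro ⟨x, hx, hx0⟩
    replace hx : ∀ h : S.Cartan H, ⁅S.incl H h, x⁆ = (l h.1 + ∑ j, c j * h.2.1 j) • x := by
      intro h
      rw [← hα]
      exact hx h
    obtain ⟨h₀, hh₀⟩ : ∃ h₀, l h₀ ≠ 0 := by
      by_contra! hcon
      exact hl (LinearMap.ext hcon)
    have hx₀ := hx (h₀, 0, 0)
    simp only [Pi.zero_apply, mul_zero, Finset.sum_const_zero, add_zero] at hx₀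
    -- brackets have no component along the `d_j`, and `h₀` kills the central component
    have hder : Algebra.der x.1 = 0 := by
      have h1 := congrArg (fun y : S.twisted => Algebra.der y.1) hx₀
      have h2 : (0 : Fin (N + 1) → ℂ) = l h₀ • Algebra.der x.1 := h1
      exact (smul_eq_zero.1 h2.symm).resolve_left hh₀
    have hcen : Algebra.cen x.1 = 0 := by
      have h1 := congrArg (fun y : S.twisted => Algebra.cen y.1) hx₀
      simp only [cen_incl_lie, map_zero, LinearMap.zero_apply] at h1
      have h2 : (0 : Forms N) = l h₀ • Algebra.cen x.1 := h1
      exact (smul_eq_zero.1 h2.symm).resolve_left hh₀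
    have hloop : Algebra.loop x.1 ≠ 0 := by
      intro h
      exact hx0 (Subtype.ext (Algebra.ext h hcen hder))
    obtain ⟨m, hm⟩ := Finsupp.ne_iff.1 hloop
    rw [Finsupp.zero_apply] at hm
    have key : ∀ h : S.Cartan H, ⁅((h.1 : S.fixed) : 𝔤), Algebra.loop x.1 m⁆ +
        (∑ p, h.2.1 p * m p) • Algebra.loop x.1 m =
          (l h.1 + ∑ j, c j * h.2.1 j) • Algebra.loop x.1 m := by
      intro h
      have h1 := congrArg (fun y : S.twisted => Algebra.loop y.1 m) (hx h)
      simp only [loop_incl_lie, Finsupp.add_apply, lieLoop_tens_zero_apply, degLoop_apply] at h1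
      rw [h1]
      rfl
    refine ⟨m, ?_, Algebra.loop x.1 m, S.apply_mem_eigen x.2.1 m, hm, fun h => ?_⟩
    · ext j
      have h1 := key (0, Pi.single j 1, 0)
      simp only [ZeroMemClass.coe_zero, zero_lie, map_zero, zero_add] at h1
      have h2 := smul_left_injective ℂ hm h1
      simpa [Pi.single_apply] using h2.symm
    · have h1 := key (h, 0, 0)
      simpa using h1
  · rintro ⟨k, rfl, x, hx, hx0, hxl⟩
    refine ⟨⟨Algebra.mk (tens k x) 0 0, Submodule.subset_span ⟨k, x, hx, rfl⟩, zero_mem _⟩, ?_, ?_⟩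
    · intro h
      rw [hα]
      apply Subtype.ext
      apply Algebra.ext
      · rw [loop_incl_lie]
        simp only [Algebra.loop_mk, lieLoop_tens, degLoop_tens, hxl, zero_add, map_smul]
        rw [← add_smul]
        simp only [mul_comm]
        rfl
      · rw [cen_incl_lie]
        simp
      · rw [LieSubalgebra.coe_bracket, Algebra.der_lie]
        simp
    · intro h
      have h1 : tens k x = (0 : Loop N 𝔤) := congrArg (fun y : S.twisted => Algebra.loop y.1) h
      simp [tens, hx0] at h1

variable {H} {ℓ : ℕ} {d : Basis (Fin ℓ) ℂ H} {κ : ℂ}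

/-- The vector of `𝔥` that corresponds, under the bilinear form, to a linear form with component
`l` on `H` and coefficients `c` along the `δ_j`. -/
theorem bilin_apply_eq (hκ : κ ≠ 0)
    (hK : ∀ h h' : H, killingForm ℂ 𝔤 ((h : S.fixed) : 𝔤) ((h' : S.fixed) : 𝔤) =
      κ * ∑ i, d.repr h i * d.repr h' i) (l : Dual ℂ H) (c : Fin (N + 1) → ℂ) :
    S.bilin H (∑ i, (κ⁻¹ * l (d i)) • d i, 0, c) = S.extend H l + ∑ j, c j • S.delta H j := by
  refine LinearMap.ext fun y => ?_
  have h1 : l y.1 = ∑ i, d.repr y.1 i * l (d i) :=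
    (congrArg l (d.sum_repr y.1).symm).trans (by simp only [map_sum, map_smul, smul_eq_mul])
  have h2 : ∀ i, d.repr (∑ j, (κ⁻¹ * l (d j)) • d j) i = κ⁻¹ * l (d i) := by
    intro i
    rw [d.repr_sum_self]
  simp only [bilin, LinearMap.mk₂_apply, hK, h2, extend, delta, LinearMap.add_apply,
    LinearMap.comp_apply, LinearMap.fst_apply, h1, LinearMap.sum_apply, LinearMap.smul_apply,
    LinearMap.snd_apply, LinearMap.proj_apply, smul_eq_mul, Pi.zero_apply, zero_mul, zero_add]
  rw [Finset.mul_sum]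
  congr 1
  refine Finset.sum_congr rfl fun i _ => ?_
  field_simp

/-- The form on `𝔥` is nondegenerate if the Killing form is, up to a nonzero factor, the standard
form in the coordinates of some basis of `H`. -/
theorem bilin_nondegenerate (hκ : κ ≠ 0)
    (hK : ∀ h h' : H, killingForm ℂ 𝔤 ((h : S.fixed) : 𝔤) ((h' : S.fixed) : 𝔤) =
      κ * ∑ i, d.repr h i * d.repr h' i) : (S.bilin H).Nondegenerate := by
  have hsymm : ∀ x y, S.bilin H x y = S.bilin H y x := by
    intro x y
    simp only [bilin, LinearMap.mk₂_apply]
    rw [LieModule.traceForm_comm]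
    congr 1
    exact Finset.sum_congr rfl fun j _ => by ring
  have hleft : ∀ x, (∀ y, S.bilin H x y = 0) → x = 0 := by
    rintro ⟨h, a, b⟩ hx
    refine Prod.ext ?_ (Prod.ext ?_ ?_)
    · apply d.repr.injective
      ext i
      have h1 := hx (d i, 0, 0)
      simpa [bilin, hK, hκ, Finsupp.single_apply] using h1
    · ext j
      have h1 := hx (0, 0, Pi.single j 1)
      simpa [bilin, Pi.single_apply] using h1
    · ext j
      have h1 := hx (0, Pi.single j 1, 0)
      simpa [bilin, Pi.single_apply] using h1
  exact ⟨hleft, fun y hy => hleft y fun x => (hsymm y x).trans (hy x)⟩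

/-- The form on `𝔥*` does not see the `δ_j`, and on `H*` it is the inverse of the form on `H`. -/
theorem dualForm_eq (hκ : κ ≠ 0)
    (hK : ∀ h h' : H, killingForm ℂ 𝔤 ((h : S.fixed) : 𝔤) ((h' : S.fixed) : 𝔤) =
      κ * ∑ i, d.repr h i * d.repr h' i) (l l' : Dual ℂ H) (c c' : Fin (N + 1) → ℂ) :
    S.dualForm H (S.extend H l + ∑ j, c j • S.delta H j) (S.extend H l' + ∑ j, c' j • S.delta H j) =
      κ⁻¹ * ∑ i, l (d i) * l' (d i) := by
  have hinj : Function.Injective (S.bilin H) :=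
    LinearMap.ker_eq_bot.1 (S.bilin_nondegenerate hκ hK).ker_eq_bot
  rw [dualForm, ← S.bilin_apply_eq hκ hK l c, ← S.bilin_apply_eq hκ hK l' c',
    Function.leftInverse_invFun hinj, Function.leftInverse_invFun hinj, S.bilin_apply_eq hκ hK]
  simp only [extend, delta, LinearMap.add_apply, LinearMap.comp_apply, LinearMap.fst_apply,
    LinearMap.sum_apply, LinearMap.smul_apply, LinearMap.snd_apply, LinearMap.proj_apply,
    Pi.zero_apply, smul_eq_mul, mul_zero, Finset.sum_const_zero, add_zero, map_sum, map_smul]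
  rw [Finset.mul_sum]
  exact Finset.sum_congr rfl fun i _ => by ring

theorem mem_V_iff {α : Dual ℂ (S.Cartan H)} :
    α ∈ S.V H ↔ ∃ (l : Dual ℂ H) (c : Fin (N + 1) → ℂ),
      α = S.extend H l + ∑ j, c j • S.delta H j := by
  rw [V, Submodule.mem_sup]
  constructor
  · rintro ⟨_, ⟨l, rfl⟩, δ, hδ, rfl⟩
    obtain ⟨c, rfl⟩ := (Submodule.mem_span_range_iff_exists_fun ℂ).1 hδ
    exact ⟨l, c, rfl⟩
  · rintro ⟨l, c, rfl⟩
    exact ⟨_, ⟨l, rfl⟩, _, (Submodule.mem_span_range_iff_exists_fun ℂ).2 ⟨c, rfl⟩, rfl⟩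

/-- The root system can be computed on the joint eigenspaces: it is `R` if, for every Cartan
subalgebra `H`, the Killing form is a positive multiple of the standard form in the coordinates of
some basis of `H`, and the nonzero weights of `H` on the joint eigenspace of degree `k` are the
integral combinations of the dual basis that `R` lists in degree `k`. -/
theorem hasRootSystem_of_weights {R : Set ((Fin ℓ → ℤ) × (Fin (N + 1) → ℤ))}
    (hR : ∀ p ∈ R, p.1 ≠ 0)
    (hH : ∀ H : LieSubalgebra ℂ S.fixed, H.IsCartanSubalgebra →
      ∃ (d : Basis (Fin ℓ) ℂ H) (κ : ℝ), 0 < κ ∧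
        (∀ h h' : H, killingForm ℂ 𝔤 ((h : S.fixed) : 𝔤) ((h' : S.fixed) : 𝔤) =
          κ * ∑ i, d.repr h i * d.repr h' i) ∧
        ∀ (l : Dual ℂ H) (k : Deg N), l ≠ 0 →
          ((∃ x ∈ S.eigen k, x ≠ 0 ∧ ∀ h : H, ⁅((h : S.fixed) : 𝔤), x⁆ = l h • x) ↔
            ∃ p : Fin ℓ → ℤ, (p, k) ∈ R ∧ l = ∑ i, (p i : ℂ) • d.dualBasis i)) :
    S.HasRootSystem R := by
  intro H hHc
  obtain ⟨d, κ, hκ, hK, hw⟩ := hH H hHc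
  have hκ0 : (κ : ℂ) ≠ 0 := by exact_mod_cast hκ.ne'
  refine ⟨S.bilin_nondegenerate hκ0 hK, κ⁻¹, d.dualBasis, inv_pos.2 hκ, fun i j => ?_, ?_⟩
  · have h := S.dualForm_eq hκ0 hK (d.dualBasis i) (d.dualBasis j) 0 0
    simp only [Pi.zero_apply, zero_smul, Finset.sum_const_zero, add_zero] at h
    rw [h]
    simp [Finsupp.single_apply, eq_comm]
  have hext : ∀ p : Fin ℓ → ℤ, S.extend H (∑ i, (p i : ℂ) • d.dualBasis i) =
      ∑ i, (p i : ℂ) • S.extend H (d.dualBasis i) := by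
    intro p
    ext h <;> simp [extend]
  have heval : ∀ (p : Fin ℓ → ℤ) i, (∑ i, (p i : ℂ) • d.dualBasis i) (d i) = p i := by
    intro p i
    simp [Finsupp.single_apply]
  have hne : ∀ p : Fin ℓ → ℤ, p ≠ 0 → ∑ i, (p i : ℂ) * (p i : ℂ) ≠ 0 := by
    intro p hp h
    apply hp
    have h1 : ∑ i, p i * p i = 0 := by exact_mod_cast h
    rw [Finset.sum_eq_zero_iff_of_nonneg fun i _ => mul_self_nonneg _] at h1
    ext i
    simpa using h1 i (Finset.mem_univ i)
  ext α
  constructor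
  · rintro ⟨hV, hroot, hform⟩
    obtain ⟨l, c, rfl⟩ := S.mem_V_iff.1 hV
    rw [S.dualForm_eq hκ0 hK] at hform
    have hl : l ≠ 0 := by
      rintro rfl
      simp at hform
    obtain ⟨k, rfl, hk⟩ := (S.rootSpace_ne_bot_iff H hl c).1 hroot
    obtain ⟨p, hp, rfl⟩ := (hw l k hl).1 hk
    exact ⟨(p, k), hp, by simp only [hext]⟩
  · rintro ⟨⟨p, k⟩, hp, rfl⟩
    set l : Dual ℂ H := ∑ i, (p i : ℂ) • d.dualBasis i with hl
    have hl0 : l ≠ 0 := by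
      intro h
      apply hR _ hp
      ext i
      have h1 := heval p i
      rw [← hl, h, LinearMap.zero_apply] at h1
      exact_mod_cast h1.symm
    simp only [← hext, ← hl]
    refine ⟨S.mem_V_iff.2 ⟨l, _, rfl⟩, (S.rootSpace_ne_bot_iff H hl0 _).2
      ⟨k, rfl, (hw l k hl0).2 ⟨p, hp, rfl⟩⟩, ?_⟩
    rw [S.dualForm_eq hκ0 hK]
    refine mul_ne_zero (inv_ne_zero hκ0) ?_
    simp only [hl, heval]
    exact hne p (hR _ hp)

end Family
end

end

open Module Matrix

attribute [local instance 100] LieRing.ofAssociativeRing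

/-! ### The matrix form of the symmetric bilinear form -/

section

variable {ℓ m : ℕ}

theorem opp_inj {b c : Col ℓ m} : opp b = opp c ↔ b = c :=
  (Function.Involutive.injective opp_opp).eq_iff

theorem gram_mul_self : gram ℓ m * gram ℓ m = 1 := by
  ext b c
  simp [gram, Matrix.mul_apply, Matrix.one_apply, opp_opp]

theorem gram_transpose : (gram ℓ m)ᵀ = gram ℓ m := by
  ext b c
  rw [transpose_apply, gram_apply, gram_apply]
  congr 1
  exact propext ⟨fun h => by rw [h, opp_opp], fun h => by rw [h, opp_opp]⟩

theorem gram_mul_mul_gram_apply (Y : Matrix (Col ℓ m) (Col ℓ m) ℂ) (b c : Col ℓ m) :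
    (gram ℓ m * Y * gram ℓ m) b c = Y (opp b) (opp c) := by
  have h1 : ∀ b c, (gram ℓ m * Y) b c = Y (opp b) c := by
    intro b c
    rw [← gram_transpose]
    simp [Matrix.mul_apply, gram_apply]
  simp [Matrix.mul_apply (M := gram ℓ m * Y), h1, gram_apply]

theorem gram_mul_single_mul_gram (b c : Col ℓ m) :
    gram ℓ m * single b c 1 * gram ℓ m = single (opp b) (opp c) 1 := by
  ext a a'
  rw [gram_mul_mul_gram_apply, single_apply, single_apply]
  congr 1
  rw [← opp_inj (b := b), ← opp_inj (b := c), opp_opp, opp_opp]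

theorem diagonal_mul_single_one {n : Type*} [Fintype n] [DecidableEq n] (D : n → ℂ) (a b : n) :
    diagonal D * single a b 1 = D a • single a b (1 : ℂ) := by
  ext i j
  rw [diagonal_mul, Matrix.smul_apply, single_apply, smul_eq_mul]
  split_ifs with h
  · rw [h.1]
  · simp

theorem single_one_mul_diagonal {n : Type*} [Fintype n] [DecidableEq n] (D : n → ℂ) (a b : n) :
    single a b (1 : ℂ) * diagonal D = D b • single a b (1 : ℂ) := by
  ext i j
  rw [mul_diagonal, Matrix.smul_apply, single_apply, smul_eq_mul, mul_comm]
  split_ifs with h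
  · rw [h.2]
  · simp

theorem wtEval_opp (c : Fin ℓ → ℂ) (b : Col ℓ m) : wtEval c (opp b) = -wtEval c b := by
  simp [wtEval, wt_opp]

theorem sum_wtEval_mul (c c' : Fin ℓ → ℂ) :
    ∑ b : Col ℓ m, wtEval c b * wtEval c' b = 2 * ∑ i, c i * c' i := by
  have h1 : ∀ (c : Fin ℓ → ℂ) i, wtEval c (Sum.inl (Sum.inl i) : Col ℓ m) = c i := by
    intro c i
    simp [wtEval, wt, Pi.single_apply]
  have h2 : ∀ (c : Fin ℓ → ℂ) i, wtEval c (Sum.inl (Sum.inr i) : Col ℓ m) = -c i := by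
    intro c i
    simp [wtEval, wt, Pi.single_apply]
  have h3 : ∀ (c : Fin ℓ → ℂ) j, wtEval c (Sum.inr j : Col ℓ m) = 0 := by
    intro c i
    simp [wtEval, wt]
  simp only [Fintype.sum_sum_type, h1, h2, h3]
  simp [two_mul]

/-! ### Differences of weights -/

/-- A nonzero difference of two weights is a root of `BC_ℓ`; it is long in `C_ℓ` only if the labels
are opposite, and it is short unless both labels belong to the block of size `2ℓ`. -/
theorem wt_sub_wt_cases {b c : Col ℓ m} (h : wt b - wt c ≠ 0) :
    wt b - wt c ∈ shortB ℓ ∨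
      (wt b - wt c ∈ longB ℓ ∧ ∀ k, (sgn k b : ℂ) = 1 ∧ (sgn k c : ℂ) = 1) ∨
      (wt b - wt c ∈ longC ℓ ∧ c = opp b ∧ ∀ k, (sgn k b : ℂ) = 1 ∧ (sgn k c : ℂ) = 1) := by
  rcases b with (i | i) | i <;> rcases c with (j | j) | j
  · refine Or.inr (Or.inl ⟨⟨i, j, 1, -1, ?_, ?_⟩, fun k => ⟨rfl, rfl⟩⟩)
    · rintro rfl; exact h (sub_self _)
    · simp [wt, Pi.single_neg, sub_eq_add_neg]
  · by_cases hij : i = j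
    · subst hij
      exact Or.inr (Or.inr ⟨⟨i, 1, by simp [wt, ← Pi.single_add]⟩, rfl, fun k => ⟨rfl, rfl⟩⟩)
    · exact Or.inr (Or.inl ⟨⟨i, j, 1, 1, hij, by simp [wt]⟩, fun k => ⟨rfl, rfl⟩⟩)
  · exact Or.inl ⟨i, 1, by simp [wt]⟩
  · by_cases hij : i = j
    · subst hij
      exact Or.inr (Or.inr ⟨⟨i, -1, by simp [wt, sub_eq_add_neg, ← Pi.single_neg,
        ← Pi.single_add]⟩, rfl, fun k => ⟨rfl, rfl⟩⟩)
    · exact Or.inr (Or.inl ⟨⟨i, j, -1, -1, hij, by simp [wt, Pi.single_neg, sub_eq_add_neg]⟩,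
        fun k => ⟨rfl, rfl⟩⟩)
  · refine Or.inr (Or.inl ⟨⟨i, j, -1, 1, ?_, ?_⟩, fun k => ⟨rfl, rfl⟩⟩)
    · rintro rfl; exact h (sub_self _)
    · simp [wt, Pi.single_neg]
  · exact Or.inl ⟨i, -1, by simp [wt, Pi.single_neg]⟩
  · exact Or.inl ⟨j, -1, by simp [wt, Pi.single_neg]⟩
  · exact Or.inl ⟨j, 1, by simp [wt]⟩
  · exact absurd (sub_self _) h

/-- The label of the basis vector of weight `± ε_i`. -/
def signedLabel (i : Fin ℓ) (s : ℤˣ) : Col ℓ m := Sum.inl (if s = 1 then Sum.inl i else Sum.inr i)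

theorem wt_signedLabel (i : Fin ℓ) (s : ℤˣ) :
    wt (signedLabel i s : Col ℓ m) = Pi.single i (s : ℤ) := by
  rcases Int.units_eq_one_or s with rfl | rfl <;> simp [signedLabel, wt, Pi.single_neg]

theorem opp_signedLabel (i : Fin ℓ) (s : ℤˣ) :
    opp (signedLabel i s : Col ℓ m) = signedLabel i (-s) := by
  rcases Int.units_eq_one_or s with rfl | rfl <;> simp [signedLabel, opp]

theorem sgn_signedLabel (k : ℕ) (i : Fin ℓ) (s : ℤˣ) : sgn k (signedLabel i s : Col ℓ m) = 1 := rfl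

theorem signedLabel_ne {i j : Fin ℓ} (hij : i ≠ j) (s t : ℤˣ) :
    (signedLabel i s : Col ℓ m) ≠ signedLabel j t := by
  intro h
  rcases Int.units_eq_one_or s with rfl | rfl <;> rcases Int.units_eq_one_or t with rfl | rfl <;>
    simp [signedLabel, hij] at h

/-- A short root comes with every pattern of signs. -/
theorem exists_labels_of_mem_shortB {p : Fin ℓ → ℤ} (hp : p ∈ shortB ℓ) (s : ℕ → ℤ) :
    ∃ b c : Col ℓ m, wt b - wt c = p ∧ c ≠ opp b ∧ ∀ k ≤ m, sgn k b * sgn k c = (-1) ^ s k := by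
  obtain ⟨i, t, rfl⟩ := hp
  obtain ⟨j, hj⟩ := exists_signs_eq m s
  refine ⟨signedLabel i t, Sum.inr j, ?_, ?_, fun k hk => ?_⟩
  · rw [wt_signedLabel]; simp [wt]
  · rw [opp_signedLabel]; simp [signedLabel]
  · rw [sgn_signedLabel, one_mul, ← hj k hk]; rfl

theorem exists_labels_of_mem_longB {p : Fin ℓ → ℤ} (hp : p ∈ longB ℓ) :
    ∃ b c : Col ℓ m, wt b - wt c = p ∧ c ≠ opp b ∧ ∀ k, sgn k b * sgn k c = 1 := by
  obtain ⟨i, j, s, t, hij, rfl⟩ := hp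
  refine ⟨signedLabel i s, opp (signedLabel j t), ?_, ?_, fun k => ?_⟩
  · rw [wt_opp, wt_signedLabel, wt_signedLabel, sub_neg_eq_add]
  · rw [opp_signedLabel, opp_signedLabel]
    exact signedLabel_ne hij.symm _ _
  · rw [sgn_opp, sgn_signedLabel, sgn_signedLabel, one_mul]

theorem exists_labels_of_mem_longC {p : Fin ℓ → ℤ} (hp : p ∈ longC ℓ) :
    ∃ b c : Col ℓ m, wt b - wt c = p ∧ ∀ k, sgn k b * sgn k c = 1 := by
  obtain ⟨i, s, rfl⟩ := hp
  refine ⟨signedLabel i s, opp (signedLabel i s), ?_, fun k => ?_⟩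
  · rw [wt_opp, wt_signedLabel, sub_neg_eq_add, ← Pi.single_add, two_mul]
  · rw [sgn_opp, sgn_signedLabel, one_mul]

theorem ne_zero_of_mem_shortB {p : Fin ℓ → ℤ} (hp : p ∈ shortB ℓ) : p ≠ 0 := by
  obtain ⟨i, s, rfl⟩ := hp
  simp

theorem ne_zero_of_mem_longB {p : Fin ℓ → ℤ} (hp : p ∈ longB ℓ) : p ≠ 0 := by
  obtain ⟨i, j, s, t, hij, rfl⟩ := hp
  intro h
  have := congrFun h i
  simp [hij] at this

theorem ne_zero_of_mem_longC {p : Fin ℓ → ℤ} (hp : p ∈ longC ℓ) : p ≠ 0 := by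
  obtain ⟨i, s, rfl⟩ := hp
  simp

/-! ### Weight vectors in matrix algebras -/

namespace IsHyperbolicBasis

variable {H : Type*} [AddCommGroup H] [Module ℂ H] {μ : H → Matrix (Idx ℓ m) (Idx ℓ m) ℂ}
  {d : Basis (Fin ℓ) ℂ H} {P : Matrix (Idx ℓ m) (Col ℓ m) ℂ}

theorem exists_inverse (hP : IsHyperbolicBasis μ d P) :
    ∃ Q : Matrix (Col ℓ m) (Idx ℓ m) ℂ, Q * P = 1 ∧ P * Q = 1 ∧ Qᵀ = P * gram ℓ m ∧
      Pᵀ = gram ℓ m * Q ∧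
      (∀ k, Q * J ℓ m k = (diagonal (sgn k) : Matrix (Col ℓ m) (Col ℓ m) ℂ) * Q) ∧
      ∀ h, Q * μ h = (diagonal (wtEval (d.repr h)) : Matrix (Col ℓ m) (Col ℓ m) ℂ) * Q := by
  obtain ⟨Q, hQ⟩ : ∃ Q, Q = gram ℓ m * Pᵀ := ⟨_, rfl⟩
  have hQP : Q * P = 1 := by rw [hQ, Matrix.mul_assoc, hP.gram_eq, gram_mul_self]
  have hPQ : P * Q = 1 := (Matrix.mul_eq_one_comm_of_card_eq _ _ _ (by simp; ring)).1 hQP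
  have hD : ∀ (A : Matrix (Idx ℓ m) (Idx ℓ m) ℂ) (D : Matrix (Col ℓ m) (Col ℓ m) ℂ),
      A * P = P * D → Q * A = D * Q := by
    intro A D h
    calc Q * A = Q * (A * P) * Q := by
          rw [Matrix.mul_assoc Q, Matrix.mul_assoc A, hPQ, Matrix.mul_one]
      _ = Q * P * D * Q := by rw [h, Matrix.mul_assoc Q P D]
      _ = D * Q := by rw [hQP, Matrix.one_mul]
  refine ⟨Q, hQP, hPQ, ?_, ?_, fun k => hD _ _ (hP.J_mul_eq k), fun h => hD _ _ (hP.mul_eq h)⟩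
  · rw [hQ, Matrix.transpose_mul, Matrix.transpose_transpose, gram_transpose]
  · rw [hQ, ← Matrix.mul_assoc, gram_mul_self, Matrix.one_mul]

theorem trace_mul (hP : IsHyperbolicBasis μ d P) (h h' : H) :
    (μ h * μ h').trace = 2 * ∑ i, d.repr h i * d.repr h' i := by
  obtain ⟨Q, hQP, hPQ, -, -, -, hμ⟩ := hP.exists_inverse
  have h1 : μ h * μ h' = P * ((diagonal (wtEval (d.repr h)) : Matrix (Col ℓ m) (Col ℓ m) ℂ) *
      (diagonal (wtEval (d.repr h')) : Matrix (Col ℓ m) (Col ℓ m) ℂ) * Q) := by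
    calc μ h * μ h' = μ h * P * (Q * μ h') := by
          rw [Matrix.mul_assoc, ← Matrix.mul_assoc P, hPQ, Matrix.one_mul]
      _ = _ := by
          rw [hP.mul_eq, hμ]
          simp only [Matrix.mul_assoc]
  rw [h1, Matrix.trace_mul_comm, Matrix.mul_assoc, hQP, Matrix.mul_one,
    diagonal_mul_diagonal, trace_diagonal, sum_wtEval_mul]

/-- The weight and the signs of a weight vector can be read off from a nonzero entry of its matrix
in the hyperbolic basis. The condition on the transpose exchanges the entries at `(b, c)` and at
`(opp c, opp b)` up to the factor `-e`, so an entry at `(b, opp b)` can be nonzero only for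
`e = -1`. -/
theorem exists_labels (hP : IsHyperbolicBasis μ d P) {X : Matrix (Idx ℓ m) (Idx ℓ m) ℂ}
    (hX : X ≠ 0) {e : ℂ} (hT : Xᵀ = -(e • X)) {s : ℕ → ℂ}
    (hJ : ∀ k ≤ m, J ℓ m k * X * J ℓ m k = s k • X) {l : H → ℂ}
    (hl : ∀ h, μ h * X - X * μ h = l h • X) :
    ∃ b c : Col ℓ m, (∀ h, l h = wtEval (d.repr h) b - wtEval (d.repr h) c) ∧
      (∀ k ≤ m, sgn k b * sgn k c = s k) ∧ (c = opp b → e = -1) := by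
  obtain ⟨Q, hQP, hPQ, hQT, hPT, hJQ, hμQ⟩ := hP.exists_inverse
  set Y := Q * X * P with hY
  have hXY : X = P * Y * Q := by
    calc X = (P * Q) * X * (P * Q) := by rw [hPQ, Matrix.one_mul, Matrix.mul_one]
      _ = _ := by simp only [hY, Matrix.mul_assoc]
  obtain ⟨b, c, hbc⟩ : ∃ b c, Y b c ≠ 0 := by
    by_contra! hcon
    apply hX
    rw [hXY, show Y = 0 from Matrix.ext hcon, Matrix.mul_zero, Matrix.zero_mul]
  refine ⟨b, c, fun h => ?_, fun k hk => ?_, ?_⟩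
  · have h1 : diagonal (wtEval (d.repr h)) * Y - Y * diagonal (wtEval (d.repr h)) = l h • Y := by
      calc _ = Q * μ h * X * P - Q * X * (μ h * P) := by
            rw [hμQ, hP.mul_eq h]
            simp only [hY, Matrix.mul_assoc]
        _ = Q * (μ h * X - X * μ h) * P := by
            simp only [Matrix.mul_sub, Matrix.sub_mul, Matrix.mul_assoc]
        _ = l h • Y := by rw [hl, Matrix.mul_smul, Matrix.smul_mul]
    have h2 := congrFun (congrFun h1 b) c
    rw [Matrix.sub_apply, diagonal_mul, mul_diagonal, Matrix.smul_apply, smul_eq_mul,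
      mul_comm (Y b c), ← sub_mul] at h2
    exact (mul_right_cancel₀ hbc h2).symm
  · have h1 : diagonal (sgn k) * Y * diagonal (sgn k) = s k • Y := by
      calc _ = Q * J ℓ m k * X * (J ℓ m k * P) := by
            rw [hJQ, hP.J_mul_eq k]
            simp only [hY, Matrix.mul_assoc]
        _ = Q * (J ℓ m k * X * J ℓ m k) * P := by simp only [Matrix.mul_assoc]
        _ = s k • Y := by rw [hJ k hk, Matrix.mul_smul, Matrix.smul_mul]
    have h2 := congrFun (congrFun h1 b) c
    rw [mul_diagonal, diagonal_mul, Matrix.smul_apply, smul_eq_mul, mul_right_comm] at h2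
    exact mul_right_cancel₀ hbc h2
  · rintro rfl
    have h1 : Yᵀ = -(e • (gram ℓ m * Y * gram ℓ m)) := by
      rw [hY, Matrix.transpose_mul, Matrix.transpose_mul, hT, hQT, hPT]
      simp only [Matrix.mul_neg, Matrix.neg_mul, Matrix.mul_smul, Matrix.smul_mul,
        Matrix.mul_assoc]
    have h4 := congrFun (congrFun h1 (opp b)) b
    rw [transpose_apply, Matrix.neg_apply, Matrix.smul_apply, gram_mul_mul_gram_apply, opp_opp,
      smul_eq_mul, ← neg_mul] at h4
    have h5 : -e = 1 := (mul_right_cancel₀ hbc ((one_mul _).trans h4)).symm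
    rw [← h5, neg_neg]

/-- Every pair of labels for which the condition of `exists_labels` holds comes from a weight
vector, namely from a symmetrized matrix unit in the hyperbolic basis. -/
theorem exists_weight_vector (hP : IsHyperbolicBasis μ d P) (b c : Col ℓ m) {e : ℂ}
    (he : e * e = 1) (hbc : c = opp b → e = -1) :
    ∃ X : Matrix (Idx ℓ m) (Idx ℓ m) ℂ, X ≠ 0 ∧ Xᵀ = -(e • X) ∧
      (∀ k, J ℓ m k * X * J ℓ m k = (sgn k b * sgn k c) • X) ∧
      ∀ h, μ h * X - X * μ h = (wtEval (d.repr h) b - wtEval (d.repr h) c) • X := by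
  obtain ⟨Q, hQP, hPQ, hQT, hPT, hJQ, hμQ⟩ := hP.exists_inverse
  set Y : Matrix (Col ℓ m) (Col ℓ m) ℂ := single b c 1 - e • single (opp c) (opp b) 1 with hY
  refine ⟨P * Y * Q, ?_, ?_, fun k => ?_, fun h => ?_⟩
  · intro h0
    have h1 : Y = 0 := by
      calc Y = Q * P * Y * (Q * P) := by rw [hQP, Matrix.one_mul, Matrix.mul_one]
        _ = Q * (P * Y * Q) * P := by simp only [Matrix.mul_assoc]
        _ = 0 := by rw [h0, Matrix.mul_zero, Matrix.zero_mul]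
    have h2 := congrFun (congrFun h1 b) c
    by_cases hcb : c = opp b
    · rw [hY, hbc hcb, hcb, opp_opp] at h2
      simp at h2
    · have : ¬ (opp c = b ∧ opp b = c) := fun h => hcb h.2.symm
      simp [hY, this] at h2
  · have h1 : gram ℓ m * Yᵀ * gram ℓ m = -(e • Y) := by
      rw [hY, transpose_sub, transpose_smul, transpose_single, transpose_single, Matrix.mul_sub,
        Matrix.sub_mul, Matrix.mul_smul, Matrix.smul_mul, gram_mul_single_mul_gram,
        gram_mul_single_mul_gram, opp_opp, opp_opp, smul_sub, smul_smul, he, one_smul, neg_sub]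
    calc (P * Y * Q)ᵀ = P * (gram ℓ m * Yᵀ * gram ℓ m) * Q := by
          rw [Matrix.transpose_mul, Matrix.transpose_mul, hQT, hPT]
          simp only [Matrix.mul_assoc]
      _ = _ := by rw [h1, Matrix.mul_neg, Matrix.neg_mul, Matrix.mul_smul, Matrix.smul_mul]
  · have h1 : diagonal (sgn k) * Y * diagonal (sgn k) = (sgn k b * sgn k c) • Y := by
      simp only [hY, Matrix.mul_sub, Matrix.sub_mul, Matrix.mul_smul, Matrix.smul_mul,
        diagonal_mul_single_one, single_one_mul_diagonal, smul_smul, smul_sub, sgn_opp]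
      congr 2
      ring
    calc J ℓ m k * (P * Y * Q) * J ℓ m k = J ℓ m k * P * Y * (Q * J ℓ m k) := by
          simp only [Matrix.mul_assoc]
      _ = P * (diagonal (sgn k) * Y * diagonal (sgn k)) * Q := by
          rw [hP.J_mul_eq k, hJQ]
          simp only [Matrix.mul_assoc]
      _ = _ := by rw [h1, Matrix.mul_smul, Matrix.smul_mul]
  · have h1 : diagonal (wtEval (d.repr h)) * Y - Y * diagonal (wtEval (d.repr h)) =
        (wtEval (d.repr h) b - wtEval (d.repr h) c) • Y := by
      simp only [hY, Matrix.mul_sub, Matrix.sub_mul, Matrix.mul_smul, Matrix.smul_mul,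
        diagonal_mul_single_one, single_one_mul_diagonal, wtEval_opp, smul_sub, sub_smul, neg_smul]
      module
    calc μ h * (P * Y * Q) - P * Y * Q * μ h = μ h * P * Y * Q - P * Y * (Q * μ h) := by
          simp only [Matrix.mul_assoc]
      _ = P * (diagonal (wtEval (d.repr h)) * Y - Y * diagonal (wtEval (d.repr h))) * Q := by
          rw [hP.mul_eq h, hμQ]
          simp only [Matrix.mul_assoc, Matrix.mul_sub, Matrix.sub_mul]
      _ = _ := by rw [h1, Matrix.mul_smul, Matrix.smul_mul]

end IsHyperbolicBasis
end

/-! ### Killing forms of the classical Lie algebras -/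

section

variable {n : Type*} [Fintype n] [DecidableEq n]

/-- The trace of an endomorphism of a matrix algebra, computed on the matrix units. -/
theorem trace_end_matrix (f : Module.End ℂ (Matrix n n ℂ)) :
    LinearMap.trace ℂ _ f = ∑ i, ∑ j, f (single i j 1) i j := by
  rw [LinearMap.trace_eq_matrix_trace ℂ (Matrix.stdBasis ℂ n n), Matrix.trace,
    Fintype.sum_prod_type]
  refine Finset.sum_congr rfl fun i _ => Finset.sum_congr rfl fun j _ => ?_
  rw [Matrix.diag_apply, LinearMap.toMatrix_apply, Matrix.stdBasis_eq_single]
  rfl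

theorem mul_single_mul_apply (A B : Matrix n n ℂ) (i j k l : n) :
    (A * single i j (1 : ℂ) * B) k l = A k i * B j l := by
  simp [Matrix.mul_apply, single_apply, Finset.sum_ite_eq, ite_and]

theorem trace_mul_mul (A B : Matrix n n ℂ) :
    ∑ i : n, ∑ j : n, (A * single i j (1 : ℂ) * B) i j = A.trace * B.trace := by
  simp only [mul_single_mul_apply, Matrix.trace, Matrix.diag_apply, Finset.sum_mul_sum]

theorem trace_mul_transpose_mul (A B : Matrix n n ℂ) :
    ∑ i : n, ∑ j : n, (A * single j i (1 : ℂ) * B) i j = (A * Bᵀ).trace := by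
  simp only [mul_single_mul_apply]
  simp only [Matrix.trace, Matrix.diag_apply, Matrix.mul_apply, transpose_apply]

theorem ad_ad_apply (x y X : Matrix n n ℂ) :
    ⁅x, ⁅y, X⁆⁆ = x * y * X * 1 - x * X * y - y * X * x + 1 * X * (y * x) := by
  simp only [Ring.lie_def]
  noncomm_ring

/-- The trace form of the adjoint representation of `gl_n`. -/
theorem trace_ad_ad (x y : Matrix n n ℂ) :
    LinearMap.trace ℂ _ (LieAlgebra.ad ℂ (Matrix n n ℂ) x ∘ₗ LieAlgebra.ad ℂ (Matrix n n ℂ) y) =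
      2 * Fintype.card n * (x * y).trace - 2 * (x.trace * y.trace) := by
  rw [trace_end_matrix]
  simp only [LinearMap.comp_apply, LieAlgebra.ad_apply, ad_ad_apply, Matrix.add_apply,
    Matrix.sub_apply, Finset.sum_add_distrib, Finset.sum_sub_distrib, trace_mul_mul,
    Matrix.trace_one, Matrix.trace_mul_comm y x]
  ring

theorem trace_ad_ad_transpose {x y : Matrix n n ℂ} (hx : xᵀ = -x) (hy : yᵀ = -y) :
    LinearMap.trace ℂ _ (LieAlgebra.ad ℂ (Matrix n n ℂ) x ∘ₗ LieAlgebra.ad ℂ (Matrix n n ℂ) y ∘ₗ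
      (Matrix.transposeLinearEquiv n n ℂ ℂ : Matrix n n ℂ →ₗ[ℂ] Matrix n n ℂ)) =
      4 * (x * y).trace := by
  have hT : ∀ X, (Matrix.transposeLinearEquiv n n ℂ ℂ : Matrix n n ℂ →ₗ[ℂ] Matrix n n ℂ) X = Xᵀ :=
    fun _ => rfl
  rw [trace_end_matrix]
  simp only [LinearMap.comp_apply, LieAlgebra.ad_apply, hT, transpose_single, ad_ad_apply,
    Matrix.add_apply, Matrix.sub_apply, Finset.sum_add_distrib, Finset.sum_sub_distrib,
    trace_mul_transpose_mul]
  simp only [transpose_one, transpose_mul, hx, hy, Matrix.mul_one, Matrix.one_mul, Matrix.mul_neg,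
    Matrix.neg_mul, Matrix.trace_neg, neg_neg, Matrix.trace_mul_comm y x]
  ring

/-- The Killing form of a Lie subalgebra `K` as a trace on the ambient Lie algebra, by means of an
endomorphism `g` with values in `K` that extends `ad x ∘ ad y`. -/
theorem killingForm_eq_trace {L : Type*} [LieRing L] [LieAlgebra ℂ L] [FiniteDimensional ℂ L]
    (K : LieSubalgebra ℂ L) (x y : K) (g : Module.End ℂ L) (hg : ∀ X, g X ∈ K)
    (hgK : ∀ X ∈ K, g X = ⁅(x : L), ⁅(y : L), X⁆⁆) :
    killingForm ℂ K x y = LinearMap.trace ℂ L g := by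
  rw [killingForm_apply_apply,
    ← LinearMap.trace_restrict_eq_of_forall_mem K.toSubmodule g hg]
  congr 1
  ext X
  exact (hgK X.1 X.2).symm

theorem killingForm_sl (x y : LieAlgebra.SpecialLinear.sl n ℂ) :
    killingForm ℂ (LieAlgebra.SpecialLinear.sl n ℂ) x y =
      2 * Fintype.card n * ((x : Matrix n n ℂ) * (y : Matrix n n ℂ)).trace := by
  have hx : (x : Matrix n n ℂ).trace = 0 := x.2
  rw [killingForm_eq_trace _ x y (LieAlgebra.ad ℂ (Matrix n n ℂ) x.1 ∘ₗ
    LieAlgebra.ad ℂ (Matrix n n ℂ) y.1) (fun X => ?_) fun X _ => rfl, trace_ad_ad, hx]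
  · ring
  · change (⁅x.1, ⁅y.1, X⁆⁆ : Matrix n n ℂ).trace = 0
    rw [Ring.lie_def, Matrix.trace_sub, Matrix.trace_mul_comm, sub_self]

theorem killingForm_so (x y : LieAlgebra.Orthogonal.so n ℂ) :
    killingForm ℂ (LieAlgebra.Orthogonal.so n ℂ) x y =
      (Fintype.card n - 2) * ((x : Matrix n n ℂ) * (y : Matrix n n ℂ)).trace := by
  have hx : (x : Matrix n n ℂ)ᵀ = -x := (LieAlgebra.Orthogonal.mem_so n ℂ _).1 x.2
  have hy : (y : Matrix n n ℂ)ᵀ = -y := (LieAlgebra.Orthogonal.mem_so n ℂ _).1 y.2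
  have hxt : (x : Matrix n n ℂ).trace = 0 := by
    have h := congrArg Matrix.trace hx
    rw [Matrix.trace_transpose, Matrix.trace_neg] at h
    exact self_eq_neg.1 h
  set f := LieAlgebra.ad ℂ (Matrix n n ℂ) x.1 ∘ₗ LieAlgebra.ad ℂ (Matrix n n ℂ) y.1 with hf
  set T := (Matrix.transposeLinearEquiv n n ℂ ℂ : Matrix n n ℂ →ₗ[ℂ] Matrix n n ℂ) with hT
  have hfT : ∀ X, ((1 / 2 : ℂ) • (f - f ∘ₗ T)) X = ⁅x.1, ⁅y.1, (1 / 2 : ℂ) • (X - Xᵀ)⁆⁆ := by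
    intro X
    simp only [lie_smul, lie_sub]
    rfl
  -- antisymmetrization is a projection of all matrices onto the antisymmetric ones
  rw [killingForm_eq_trace _ x y ((1 / 2 : ℂ) • (f - f ∘ₗ T)), map_smul, map_sub, hf, trace_ad_ad,
    LinearMap.comp_assoc, hT, trace_ad_ad_transpose hx hy, hxt]
  · rw [smul_eq_mul]; ring
  · intro X
    rw [hfT]
    refine LieSubalgebra.lie_mem _ x.2 (LieSubalgebra.lie_mem _ y.2 (Submodule.smul_mem _ _ ?_))
    exact (LieAlgebra.Orthogonal.mem_so n ℂ _).2 (by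
      rw [transpose_sub, transpose_transpose, neg_sub])
  · intro X hX
    rw [hfT, (LieAlgebra.Orthogonal.mem_so n ℂ _).1 hX, sub_neg_eq_add, ← two_smul ℂ X, smul_smul]
    norm_num

end

/-! ### Orders of the automorphisms -/

namespace Family

variable {N : ℕ} {𝔤 : Type} [LieRing 𝔤] [LieAlgebra ℂ 𝔤] (S : Family N 𝔤)

theorem order_eq_two {j : Fin (N + 1)} (h : ∀ x, S.σ j (S.σ j x) = x) {x : 𝔤} (hx : S.σ j x ≠ x) :
    S.order j = 2 := by
  refine orderOf_eq_prime ?_ fun h1 => hx (LinearMap.congr_fun h1 x)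
  ext y
  exact h y

theorem order_eq_one {j : Fin (N + 1)} (h : ∀ x, S.σ j x = x) : S.order j = 1 := by
  rw [order, orderOf_eq_one_iff]
  ext y
  exact h y

theorem root_eq_neg_one {j : Fin (N + 1)} (h : S.order j = 2) : S.root j = -1 := by
  rw [root, h, ← Complex.exp_pi_mul_I]
  congr 1
  push_cast
  ring

theorem root_eq_one {j : Fin (N + 1)} (h : S.order j = 1) : S.root j = 1 := by
  rw [root, h, Nat.cast_one, div_one, Complex.exp_two_pi_mul_I]

end Family

section

variable {ℓ m n : ℕ}

theorem signJ_two_pow (k : ℕ) (hk : k ≤ m) :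
    signJ ℓ m k (Sum.inr ⟨2 ^ k, Nat.pow_lt_pow_right one_lt_two (by omega)⟩) = -1 := by
  simp [signJ]

/-- For `k ≤ m` the automorphism `Ad(J_k)` is not the identity: it changes the sign of the entries
between an index of the first block and the index `2^k` of the second block. The first block is not
empty because `ℓ ≥ 1`. -/
theorem order_familyD (hℓ : 1 ≤ ℓ) (k : Fin (n + 1)) :
    (familyD ℓ m n).order k = if k.val ≤ m then 2 else 1 := by
  have hσ : (familyD ℓ m n).σ k = if k.val ≤ m then adSo ℓ m k.val else LieEquiv.refl := rfl
  split_ifs at hσ ⊢ with hk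
  · let a : Idx ℓ m := Sum.inl ⟨0, by omega⟩
    let b : Idx ℓ m := Sum.inr ⟨2 ^ k.val, Nat.pow_lt_pow_right one_lt_two (by omega)⟩
    refine (familyD ℓ m n).order_eq_two (x := ⟨single a b 1 - single b a 1,
      (LieAlgebra.Orthogonal.mem_so _ ℂ _).2 (by simp)⟩) (fun x => ?_) fun h => ?_
    · rw [hσ]; exact adSo_involutive _ x
    · rw [hσ] at h
      have h1 := congrFun (congrFun (congrArg Subtype.val h) a) b
      rw [coe_adSo, adJ_apply, J, mul_diagonal, diagonal_mul, signJ_two_pow _ hk] at h1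
      simp [a, b, signJ] at h1
      norm_num at h1
  · exact (familyD ℓ m n).order_eq_one fun x => by rw [hσ]; rfl

theorem order_familyA (hℓ : 1 ≤ ℓ) (k : Fin (n + 1)) :
    (familyA ℓ m n).order k = if k.val ≤ m + 1 then 2 else 1 := by
  have hσ : (familyA ℓ m n).σ k = if k.val = 0 then cartanInvolution ℓ m
    else if k.val ≤ m + 1 then adSl ℓ m (k.val - 1) else LieEquiv.refl := rfl
  by_cases h0 : k.val = 0
  · rw [if_pos h0] at hσ
    rw [if_pos (by omega)]
    let a : Idx ℓ m := Sum.inl ⟨0, by omega⟩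
    let b : Idx ℓ m := Sum.inr 0
    have hmem : (single a b 1 + single b a 1 : Matrix (Idx ℓ m) (Idx ℓ m) ℂ) ∈ sl ℓ m := by
      rw [mem_sl]; simp [a, b]
    refine (familyA ℓ m n).order_eq_two (x := ⟨_, hmem⟩) (fun x => ?_) fun h => ?_
    · rw [hσ]; exact (cartanInvolution ℓ m).left_inv x
    · rw [hσ] at h
      have h1 := congrFun (congrFun (congrArg Subtype.val h) a) b
      change -(single a b 1 + single b a 1 : Matrix (Idx ℓ m) (Idx ℓ m) ℂ) b a =
        (single a b 1 + single b a 1 : Matrix (Idx ℓ m) (Idx ℓ m) ℂ) a b at h1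
      simp [a, b] at h1
      norm_num at h1
  rw [if_neg h0] at hσ
  split_ifs at hσ ⊢ with hk
  · let a : Idx ℓ m := Sum.inl ⟨0, by omega⟩
    let b : Idx ℓ m := Sum.inr ⟨2 ^ (k.val - 1), Nat.pow_lt_pow_right one_lt_two (by omega)⟩
    have hmem : (single a b 1 : Matrix (Idx ℓ m) (Idx ℓ m) ℂ) ∈ sl ℓ m := by
      rw [mem_sl]; simp [a, b]
    refine (familyA ℓ m n).order_eq_two (x := ⟨_, hmem⟩) (fun x => ?_) fun h => ?_
    · rw [hσ]; exact adSl_involutive _ x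
    · rw [hσ] at h
      have h1 := congrFun (congrFun (congrArg Subtype.val h) a) b
      rw [coe_adSl, adJ_apply, J, mul_diagonal, diagonal_mul, signJ_two_pow _ (by omega)] at h1
      simp [a, b, signJ] at h1
      norm_num at h1
  · exact (familyA ℓ m n).order_eq_one fun x => by rw [hσ]; rfl

end

section

variable {ℓ m n : ℕ}

/-! ### Weights of the joint eigenspaces -/

/-- The nonzero weights on the joint eigenspaces, for matrices that satisfy `Xᵀ = -e X` and
`J_k X J_k = (-1)^{s_k} X`, are the short roots of `B_ℓ`, for all even `s_k` also its long
roots, and for all even `s_k` and symmetric matrices, i.e. `e = -1`, also the long roots of `C_ℓ`. -/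
theorem IsHyperbolicBasis.weight_iff {H : Type*} [AddCommGroup H] [Module ℂ H]
    {μ : H → Matrix (Idx ℓ m) (Idx ℓ m) ℂ} {d : Basis (Fin ℓ) ℂ H}
    {P : Matrix (Idx ℓ m) (Col ℓ m) ℂ} (hP : IsHyperbolicBasis μ d P) {e : ℂ} (he : e * e = 1)
    (s : ℕ → ℤ) {l : Dual ℂ H} (hl : l ≠ 0) :
    (∃ X, X ≠ 0 ∧ Xᵀ = -(e • X) ∧ (∀ k ≤ m, J ℓ m k * X * J ℓ m k = (-1 : ℂ) ^ s k • X) ∧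
      ∀ h, μ h * X - X * μ h = l h • X) ↔
    ∃ p : Fin ℓ → ℤ, (p ∈ shortB ℓ ∨ (p ∈ longB ℓ ∧ ∀ k ≤ m, Even (s k)) ∨
      (p ∈ longC ℓ ∧ e = -1 ∧ ∀ k ≤ m, Even (s k))) ∧ l = ∑ i, (p i : ℂ) • d.dualBasis i := by
  have hsub : ∀ b c : Col ℓ m, ∀ h, (∑ i, ((wt b - wt c) i : ℂ) • d.dualBasis i) h =
      wtEval (d.repr h) b - wtEval (d.repr h) c := by
    intro b c h
    simp [wtEval, sub_mul]
  have heven : ∀ a : ℤ, (-1 : ℂ) ^ a = 1 ↔ Even a := by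
    intro a
    refine ⟨fun h => ?_, fun h => h.neg_one_zpow⟩
    by_contra hodd
    rw [(Int.not_even_iff_odd.1 hodd).neg_one_zpow] at h
    norm_num at h
  constructor
  · rintro ⟨X, hX, hT, hJ, hXl⟩
    obtain ⟨b, c, hbc, hs, he'⟩ := hP.exists_labels hX hT hJ hXl
    have hlp : l = ∑ i, ((wt b - wt c) i : ℂ) • d.dualBasis i :=
      LinearMap.ext fun h => by rw [hbc, hsub]
    have hne : wt b - wt c ≠ 0 := by
      intro h0
      apply hl
      rw [hlp, h0]
      simp
    have hs1 : (∀ k, (sgn k b : ℂ) = 1 ∧ (sgn k c : ℂ) = 1) → ∀ k ≤ m, Even (s k) := by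
      intro h k hk
      rw [← heven, ← hs k hk, (h k).1, (h k).2, one_mul]
    refine ⟨wt b - wt c, ?_, hlp⟩
    rcases wt_sub_wt_cases hne with h | ⟨h, h'⟩ | ⟨h, hopp, h'⟩
    · exact Or.inl h
    · exact Or.inr (Or.inl ⟨h, hs1 h'⟩)
    · exact Or.inr (Or.inr ⟨h, he' hopp, hs1 h'⟩)
  · rintro ⟨p, hp, rfl⟩
    obtain ⟨b, c, rfl, hbc, hs⟩ : ∃ b c : Col ℓ m, wt b - wt c = p ∧ (c = opp b → e = -1) ∧
        ∀ k ≤ m, sgn k b * sgn k c = (-1 : ℂ) ^ s k := by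
      rcases hp with hp | ⟨hp, hs⟩ | ⟨hp, he', hs⟩
      · obtain ⟨b, c, h1, h2, h3⟩ := exists_labels_of_mem_shortB hp s
        exact ⟨b, c, h1, fun h => absurd h h2, h3⟩
      · obtain ⟨b, c, h1, h2, h3⟩ := exists_labels_of_mem_longB (m := m) hp
        exact ⟨b, c, h1, fun h => absurd h h2, fun k hk => by rw [h3, (heven _).2 (hs k hk)]⟩
      · obtain ⟨b, c, h1, h3⟩ := exists_labels_of_mem_longC (m := m) hp
        exact ⟨b, c, h1, fun _ => he', fun k hk => by rw [h3, (heven _).2 (hs k hk)]⟩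
    obtain ⟨X, hX, hT, hJ, hXl⟩ := hP.exists_weight_vector b c he hbc
    exact ⟨X, hX, hT, fun k hk => by rw [hJ, hs k hk], fun h => by rw [hXl, hsub]⟩

theorem familyD_σ_of_le {k : Fin (n + 1)} (hk : k.val ≤ m) :
    (familyD ℓ m n).σ k = adSo ℓ m k.val := if_pos hk

theorem familyD_σ_of_lt {k : Fin (n + 1)} (hk : m < k.val) :
    (familyD ℓ m n).σ k = LieEquiv.refl := if_neg (by omega)

theorem familyA_σ_zero : (familyA ℓ m n).σ 0 = cartanInvolution ℓ m := rfl

theorem familyA_σ_of_le {k : Fin (n + 1)} (h0 : 1 ≤ k.val) (hk : k.val ≤ m + 1) :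
    (familyA ℓ m n).σ k = adSl ℓ m (k.val - 1) :=
  (if_neg (by omega : ¬ k.val = 0)).trans (if_pos hk)

theorem familyA_σ_of_lt {k : Fin (n + 1)} (hk : m + 1 < k.val) :
    (familyA ℓ m n).σ k = LieEquiv.refl :=
  (if_neg (by omega : ¬ k.val = 0)).trans (if_neg (by omega))

theorem mem_eigen_familyD (hℓ : 1 ≤ ℓ) {K : Deg n} {x : so ℓ m} :
    x ∈ (familyD ℓ m n).eigen K ↔ ∀ k : Fin (n + 1), k.val ≤ m →
      J ℓ m k.val * x.1 * J ℓ m k.val = (-1 : ℂ) ^ K k • x.1 := by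
  rw [Family.mem_eigen]
  refine forall_congr' fun k => ?_
  by_cases hk : k.val ≤ m
  · rw [Family.root_eq_neg_one _ ((order_familyD hℓ k).trans (if_pos hk)), familyD_σ_of_le hk,
      Subtype.ext_iff, coe_adSo, adJ_apply]
    exact ⟨fun h _ => h, fun h => h hk⟩
  · rw [Family.root_eq_one _ ((order_familyD hℓ k).trans (if_neg hk)),
      familyD_σ_of_lt (not_le.1 hk), _root_.one_zpow, one_smul]
    exact ⟨fun _ h => absurd h hk, fun _ => rfl⟩

theorem mem_eigen_familyA (hℓ : 1 ≤ ℓ) {K : Deg n} {x : sl ℓ m} :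
    x ∈ (familyA ℓ m n).eigen K ↔ -x.1ᵀ = (-1 : ℂ) ^ K 0 • x.1 ∧
      ∀ k : Fin (n + 1), 1 ≤ k.val → k.val ≤ m + 1 →
        J ℓ m (k.val - 1) * x.1 * J ℓ m (k.val - 1) = (-1 : ℂ) ^ K k • x.1 := by
  rw [Family.mem_eigen]
  constructor
  · intro h
    refine ⟨?_, fun k h0 hk => ?_⟩
    · have h1 := h 0
      rw [Family.root_eq_neg_one _ ((order_familyA hℓ 0).trans (if_pos (Nat.zero_le _))),
        familyA_σ_zero] at h1
      exact congrArg Subtype.val h1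
    · have h1 := h k
      rw [Family.root_eq_neg_one _ ((order_familyA hℓ k).trans (if_pos hk)),
        familyA_σ_of_le h0 hk, Subtype.ext_iff, coe_adSl, adJ_apply] at h1
      exact h1
  · rintro ⟨hT, hJ⟩ k
    by_cases h0 : k.val = 0
    · obtain rfl : k = 0 := Fin.ext h0
      rw [Family.root_eq_neg_one _ ((order_familyA hℓ 0).trans (if_pos (Nat.zero_le _))),
        familyA_σ_zero]
      exact Subtype.ext hT
    by_cases hk : k.val ≤ m + 1
    · rw [Family.root_eq_neg_one _ ((order_familyA hℓ k).trans (if_pos hk)),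
        familyA_σ_of_le (by omega) hk, Subtype.ext_iff, coe_adSl, adJ_apply]
      exact hJ k (by omega) hk
    · rw [Family.root_eq_one _ ((order_familyA hℓ k).trans (if_neg hk)),
        familyA_σ_of_lt (not_le.1 hk), _root_.one_zpow, one_smul]
      rfl

theorem J_mul_mul_J_iff {k : ℕ} {X Y : Matrix (Idx ℓ m) (Idx ℓ m) ℂ} :
    J ℓ m k * X * J ℓ m k = Y ↔ J ℓ m k * X = Y * J ℓ m k := by
  constructor
  · rintro rfl
    rw [mul_assoc, J_mul_self, mul_one]
  · intro h
    rw [h, mul_assoc, J_mul_self, mul_one]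

/-! ### The root systems of the two families -/

/-- The embedding of the fixed point algebra of `familyD` into the matrices. -/
def fixedD (ℓ m n : ℕ) : (familyD ℓ m n).fixed →ₗ⁅ℂ⁆ Matrix (Idx ℓ m) (Idx ℓ m) ℂ :=
  (so ℓ m).incl.comp (familyD ℓ m n).fixed.incl

/-- The embedding of the fixed point algebra of `familyA` into the matrices. -/
def fixedA (ℓ m n : ℕ) : (familyA ℓ m n).fixed →ₗ⁅ℂ⁆ Matrix (Idx ℓ m) (Idx ℓ m) ℂ :=
  (sl ℓ m).incl.comp (familyA ℓ m n).fixed.incl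

/-- The fixed point algebra consists of the antisymmetric matrices that commute with all `J_k`. It
is isomorphic to `so(2ℓ + 1)`, see `apply_inr_eq_zero`. -/
theorem range_fixedD (hℓ : 1 ≤ ℓ) (hmn : m ≤ n) (X : Matrix (Idx ℓ m) (Idx ℓ m) ℂ) :
    (∃ x, fixedD ℓ m n x = X) ↔ Xᵀ = -X ∧ ∀ k ≤ m, J ℓ m k * X = X * J ℓ m k := by
  constructor
  · rintro ⟨x, rfl⟩
    refine ⟨(LieAlgebra.Orthogonal.mem_so _ ℂ _).1 x.1.2, fun k hk => ?_⟩
    have h := (mem_eigen_familyD hℓ).1 x.2 ⟨k, by omega⟩ hk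
    rw [Pi.zero_apply, zpow_zero, one_smul] at h
    exact J_mul_mul_J_iff.1 h
  · rintro ⟨hT, hJ⟩
    refine ⟨⟨⟨X, (LieAlgebra.Orthogonal.mem_so _ ℂ _).2 hT⟩, (mem_eigen_familyD hℓ).2
      fun k hk => ?_⟩, rfl⟩
    rw [Pi.zero_apply, zpow_zero, one_smul]
    exact J_mul_mul_J_iff.2 (hJ k hk)

/-- The fixed point algebra is the same one as for `familyD`, see `range_fixedD`. -/
theorem range_fixedA (hℓ : 1 ≤ ℓ) (hmn : m < n) (X : Matrix (Idx ℓ m) (Idx ℓ m) ℂ) :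
    (∃ x, fixedA ℓ m n x = X) ↔ Xᵀ = -X ∧ ∀ k ≤ m, J ℓ m k * X = X * J ℓ m k := by
  constructor
  · rintro ⟨x, rfl⟩
    obtain ⟨h1, h2⟩ := (mem_eigen_familyA hℓ).1 x.2
    rw [Pi.zero_apply, zpow_zero, one_smul] at h1
    refine ⟨neg_eq_iff_eq_neg.1 h1, fun k hk => ?_⟩
    have h := h2 ⟨k + 1, by omega⟩ (Nat.le_add_left _ _) (Nat.succ_le_succ hk)
    rw [Pi.zero_apply, zpow_zero, one_smul] at h
    exact J_mul_mul_J_iff.1 h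
  · rintro ⟨hT, hJ⟩
    have htr : X.trace = 0 := by
      have h := congrArg Matrix.trace hT
      rw [Matrix.trace_transpose, Matrix.trace_neg] at h
      exact self_eq_neg.1 h
    refine ⟨⟨⟨X, mem_sl.2 htr⟩, (mem_eigen_familyA hℓ).2 ⟨?_, fun k h0 hk => ?_⟩⟩, rfl⟩
    · rw [Pi.zero_apply, zpow_zero, one_smul, hT, neg_neg]
    · rw [Pi.zero_apply, zpow_zero, one_smul]
      exact J_mul_mul_J_iff.2 (hJ _ (by omega))

theorem fixedD_injective : Function.Injective (fixedD ℓ m n) :=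
  Subtype.val_injective.comp Subtype.val_injective

theorem fixedA_injective : Function.Injective (fixedA ℓ m n) :=
  Subtype.val_injective.comp Subtype.val_injective

theorem card_Idx (ℓ m : ℕ) : Fintype.card (Idx ℓ m) = 2 * ℓ + 2 ^ (m + 1) := by simp

/-- A multi-degree as a sequence of integers, extended by zero. -/
def degSeq (K : Deg n) (k : ℕ) : ℤ := if h : k < n + 1 then K ⟨k, h⟩ else 0

theorem degSeq_val (K : Deg n) (k : Fin (n + 1)) : degSeq K k.val = K k := dif_pos k.2

set_option maxHeartbeats 1600000 in
/-- The Killing form is `N - 2` times the trace form, where `N = 2ℓ + 2^(m+1)`, and the trace form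
is twice the standard form in the coordinates of the hyperbolic basis. Antisymmetry is the case
`e = 1` of `IsHyperbolicBasis.weight_iff`, in which the roots `±2ε_i` do not occur. -/
theorem hasRootSystem_familyD (hℓ : 1 ≤ ℓ) (hmn : m ≤ n) :
    (familyD ℓ m n).HasRootSystem (rootsB ℓ m n) := by
  apply Family.hasRootSystem_of_weights
  · rintro p (hp | ⟨hp, -⟩)
    · exact ne_zero_of_mem_shortB hp
    · exact ne_zero_of_mem_longB hp
  intro H hH
  obtain ⟨d, P, hP⟩ := exists_isHyperbolicBasis fixedD_injective (range_fixedD hℓ hmn) H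
  have hlie : ∀ (h : H) (x : so ℓ m),
      ((⁅((h : (familyD ℓ m n).fixed) : so ℓ m), x⁆ : so ℓ m) : Matrix (Idx ℓ m) (Idx ℓ m) ℂ) =
        fixedD ℓ m n h * x.1 - x.1 * fixedD ℓ m n h := fun h x => by
    rw [LieSubalgebra.coe_bracket, Ring.lie_def]
    rfl
  have hN : 4 ≤ 2 * ℓ + 2 ^ (m + 1) := by
    have : 2 ^ 1 ≤ 2 ^ (m + 1) := Nat.pow_le_pow_right two_pos (by omega)
    omega
  refine ⟨d, 2 * ((2 * ℓ + 2 ^ (m + 1) : ℕ) - 2), ?_, fun h h' => ?_, fun l K hl => ?_⟩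
  · have : (4 : ℝ) ≤ (2 * ℓ + 2 ^ (m + 1) : ℕ) := by exact_mod_cast hN
    linarith
  · have h1 := hP.trace_mul h h'
    refine (killingForm_so _ _).trans ?_
    rw [card_Idx]
    refine (congrArg _ h1).trans ?_
    push_cast
    ring
  have hw := hP.weight_iff (one_mul 1) (degSeq K) hl
  have hpar : (∀ k ≤ m, Even (degSeq K k)) ↔ ∀ k : Fin (n + 1), k.val ≤ m → Even (K k) := by
    refine ⟨fun h k hk => ?_, fun h k hk => ?_⟩
    · rw [← degSeq_val K]; exact h k hk
    · have : Even (K ⟨k, by omega⟩) := h ⟨k, by omega⟩ hk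
      rwa [← degSeq_val K] at this
  constructor
  · rintro ⟨x, hx, hx0, hxl⟩
    rw [mem_eigen_familyD hℓ] at hx
    have hx1 : x.1 ≠ 0 := fun h => hx0 (Subtype.ext h)
    have hT : x.1ᵀ = -((1 : ℂ) • x.1) := by
      rw [one_smul]; exact (LieAlgebra.Orthogonal.mem_so _ ℂ _).1 x.2
    have hJ : ∀ k ≤ m, J ℓ m k * x.1 * J ℓ m k = (-1 : ℂ) ^ degSeq K k • x.1 := fun k hk => by
      have := hx ⟨k, by omega⟩ hk
      rwa [← degSeq_val K] at this
    have hxl' : ∀ h : H, fixedD ℓ m n h * x.1 - x.1 * fixedD ℓ m n h = l h • x.1 := fun h => by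
      rw [← hlie, hxl]; rfl
    obtain ⟨p, hp, hlp⟩ := hw.1 ⟨x.1, hx1, hT, hJ, hxl'⟩
    refine ⟨p, ?_, hlp⟩
    rcases hp with hp | ⟨hp, hs⟩ | ⟨-, he, -⟩
    · exact Or.inl hp
    · exact Or.inr ⟨hp, hpar.1 hs⟩
    · norm_num at he
  · rintro ⟨p, hp, hlp⟩
    obtain ⟨X, hX0, hT, hJ, hXl⟩ := hw.2 ⟨p, by
      rcases hp with hp | ⟨hp, hs⟩
      · exact Or.inl hp
      · exact Or.inr (Or.inl ⟨hp, hpar.2 hs⟩), hlp⟩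
    rw [one_smul] at hT
    refine ⟨⟨X, (LieAlgebra.Orthogonal.mem_so _ ℂ _).2 hT⟩, (mem_eigen_familyD hℓ).2 fun k hk => ?_,
      fun h => hX0 (congrArg Subtype.val h), fun h => Subtype.ext ((hlie h _).trans (hXl h))⟩
    rw [← degSeq_val K]
    exact hJ k hk

set_option maxHeartbeats 1600000 in
/-- The Killing form is `2N` times the trace form, where `N = 2ℓ + 2^(m+1)`, and the trace form is
twice the standard form in the coordinates of the hyperbolic basis. In degree `K` the symmetry type
of `IsHyperbolicBasis.weight_iff` is `e = (-1)^(K 0)`, so the roots `±2ε_i` occur if `K 0` is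
odd. -/
theorem hasRootSystem_familyA (hℓ : 1 ≤ ℓ) (hmn : m < n) :
    (familyA ℓ m n).HasRootSystem (rootsBC ℓ m n) := by
  apply Family.hasRootSystem_of_weights
  · rintro p ((hp | ⟨hp, -⟩) | ⟨hp, -⟩)
    · exact ne_zero_of_mem_shortB hp
    · exact ne_zero_of_mem_longB hp
    · exact ne_zero_of_mem_longC hp
  intro H hH
  obtain ⟨d, P, hP⟩ := exists_isHyperbolicBasis fixedA_injective (range_fixedA hℓ hmn) H
  have hlie : ∀ (h : H) (x : sl ℓ m),
      ((⁅((h : (familyA ℓ m n).fixed) : sl ℓ m), x⁆ : sl ℓ m) : Matrix (Idx ℓ m) (Idx ℓ m) ℂ) =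
        fixedA ℓ m n h * x.1 - x.1 * fixedA ℓ m n h := fun h x => by
    rw [LieSubalgebra.coe_bracket, Ring.lie_def]
    rfl
  refine ⟨d, 4 * (2 * ℓ + 2 ^ (m + 1) : ℕ), ?_, fun h h' => ?_, fun l K hl => ?_⟩
  · positivity
  · have h1 := hP.trace_mul h h'
    refine (killingForm_sl _ _).trans ?_
    rw [card_Idx]
    refine (congrArg _ h1).trans ?_
    push_cast
    ring
  have he : (-1 : ℂ) ^ K 0 * (-1 : ℂ) ^ K 0 = 1 := by
    rw [← mul_zpow]; norm_num
  have hw := hP.weight_iff he (fun k => degSeq K (k + 1)) hl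
  have hpar : (∀ k ≤ m, Even (degSeq K (k + 1))) ↔
      ∀ k : Fin (n + 1), 1 ≤ k.val → k.val ≤ m + 1 → Even (K k) := by
    refine ⟨fun h k h0 hk => ?_, fun h k hk => ?_⟩
    · have := h (k.val - 1) (by omega)
      rwa [Nat.sub_add_cancel h0, degSeq_val] at this
    · have : Even (K ⟨k + 1, by omega⟩) :=
        h ⟨k + 1, by omega⟩ (Nat.le_add_left _ _) (Nat.succ_le_succ hk)
      rwa [← degSeq_val K] at this
  have hodd : (-1 : ℂ) ^ K 0 = -1 ↔ Odd (K 0) := by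
    refine ⟨fun h => ?_, fun h => h.neg_one_zpow⟩
    by_contra heven
    rw [(Int.not_odd_iff_even.1 heven).neg_one_zpow] at h
    norm_num at h
  constructor
  · rintro ⟨x, hx, hx0, hxl⟩
    obtain ⟨hT, hJ⟩ := (mem_eigen_familyA hℓ).1 hx
    have hx1 : x.1 ≠ 0 := fun h => hx0 (Subtype.ext h)
    have hT' : x.1ᵀ = -((-1 : ℂ) ^ K 0 • x.1) := by
      rw [← hT, neg_neg]
    have hJ' : ∀ k ≤ m, J ℓ m k * x.1 * J ℓ m k = (-1 : ℂ) ^ degSeq K (k + 1) • x.1 :=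
      fun k hk => by
        have := hJ ⟨k + 1, by omega⟩ (Nat.le_add_left _ _) (Nat.succ_le_succ hk)
        rwa [← degSeq_val K] at this
    have hxl' : ∀ h : H, fixedA ℓ m n h * x.1 - x.1 * fixedA ℓ m n h = l h • x.1 := fun h => by
      rw [← hlie, hxl]; rfl
    obtain ⟨p, hp, hlp⟩ := hw.1 ⟨x.1, hx1, hT', hJ', hxl'⟩
    refine ⟨p, ?_, hlp⟩
    rcases hp with hp | ⟨hp, hs⟩ | ⟨hp, he', hs⟩
    · exact Or.inl (Or.inl hp)
    · exact Or.inl (Or.inr ⟨hp, hpar.1 hs⟩)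
    · exact Or.inr ⟨hp, hodd.1 he', hpar.1 hs⟩
  · rintro ⟨p, hp, hlp⟩
    obtain ⟨X, hX0, hT, hJ, hXl⟩ := hw.2 ⟨p, by
      rcases hp with (hp | ⟨hp, hs⟩) | ⟨hp, ho, hs⟩
      · exact Or.inl hp
      · exact Or.inr (Or.inl ⟨hp, hpar.2 hs⟩)
      · exact Or.inr (Or.inr ⟨hp, hodd.2 ho, hpar.2 hs⟩), hlp⟩
    obtain ⟨h₀, hh₀⟩ : ∃ h₀, l h₀ ≠ 0 := by
      by_contra! hcon
      exact hl (LinearMap.ext hcon)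
    -- a weight vector of nonzero weight is a multiple of a commutator
    have htr : X.trace = 0 := by
      have h1 := congrArg Matrix.trace (hXl h₀)
      rw [Matrix.trace_sub, Matrix.trace_mul_comm, sub_self, Matrix.trace_smul, eq_comm,
        smul_eq_zero] at h1
      exact h1.resolve_left hh₀
    refine ⟨⟨X, mem_sl.2 htr⟩, (mem_eigen_familyA hℓ).2 ⟨?_, fun k h0 hk => ?_⟩,
      fun h => hX0 (congrArg Subtype.val h), fun h => Subtype.ext ((hlie h _).trans (hXl h))⟩
    · rw [hT, neg_neg]
    · have := hJ (k.val - 1) (by omega)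
      rwa [Nat.sub_add_cancel h0, degSeq_val] at this

end

end Toroidal
end

theorem mainTheorem3 (ℓ m n : ℕ) (hℓ : 1 ≤ ℓ) :
    (m ≤ n →
      (∀ k, (Toroidal.familyD ℓ m n).order k = if k.val ≤ m then 2 else 1) ∧
      (Toroidal.familyD ℓ m n).HasRootSystem (Toroidal.rootsB ℓ m n)) ∧
    (m < n →
      (∀ k, (Toroidal.familyA ℓ m n).order k = if k.val ≤ m + 1 then 2 else 1) ∧
      (Toroidal.familyA ℓ m n).HasRootSystem (Toroidal.rootsBC ℓ m n)) :=
  ⟨fun h => ⟨Toroidal.order_familyD hℓ, Toroidal.hasRootSystem_familyD hℓ h⟩,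
    fun h => ⟨Toroidal.order_familyA hℓ, Toroidal.hasRootSystem_familyA hℓ h⟩⟩
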